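/- **Setting.** For every sample size $n$ let $p=p_n$ and let the observations be $n$ independent, identically distributed copies of a vector $X=(X_1,\dots,X_p)^t$ following a linear structural equation model $X=BX+\varepsilon$, where the variables are listed in a topological order ($B\in\mathbb R^{p\times p}$ is strictly lower triangular) and $\varepsilon_1,\dots,\varepsilon_p$ are independent with mean zero and variances $v_j>0$. Put $\Sigma=(I-B)^{-1}\mathrm{diag}(v)(I-B)^{-t}$, the covariance matrix of $X$. Let $L$ be the Cholesky factor of the precision matrix, i.e. the unique lower triangular matrix with positive diagonal and $L^tL=\Sigma^{-1}$; let $\mathcal S(L)=\{(i,j): i\neq j,\ L_{ij}\neq 0\}$ and $s=s_n=|\mathcal S(L)|$. All of $p,B,v,\Sigma,L,s$ may depend on $n$. Let $S=\frac1n\sum_{k=1}^n x_kx_k^t$ be the sample covariance matrix. A CSCS estimate $\hat L$ with tuning parameter $\lambda=\lambda_n$ is a minimizer of $$\mathrm{tr}(L^tLS)-2\log|L|+\lambda\sum_{1\le j<i\le p}|L_{ij}|$$ over the lower triangular matrices $L$ with positive diagonal. Its thresholded version at level $\tau$ is $\hat L^\tau_{ij}=\hat L_{ij}\,1(|\hat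 L_{ij}|>\tau)$. **Assumptions**, with constants $C,\kappa>0$ that do not depend on $n$: * A1. $E\exp\big(tX_j/\sqrt{\Sigma_{jj}}\big)\le\exp(Ct^2)$ for all $j$ and all $t\in\mathbb R$. * A2/A3. $L$ is as above, and all its singular values lie in $[\kappa^{-1},\kappa]$. * A4. $|L_{ij}|>c_1\sqrt{s\log p/n}$ for all $(i,j)\in\mathcal S(L)$. * Scaling: $p_n\to\infty$ and $(s+p)\log p=o(n)$ as $n\to\infty$. **Theorem.** For all $C,\kappa>0$ there is $a_0=a_0(C,\kappa)>0$ such that for every $A\ge a_0$ there is $c_0=c_0(C,\kappa,A)>0$ with the following property. Let $c_2\ge c_0$ and $c_1>2c_2$, let the assumptions above hold, and let $a_0\sqrt{\log p/n}\le\lambda_n\le A\sqrt{\log p/n}$ for all $n$. Then, with probability tending to $1$ as $n\to\infty$, a CSCS estimate exists, and every CSCS estimate $\hat L$ satisfies $$\Big(\sum_{i\ne j}(\hat L_{ij}-L_{ij})^2\Big)^{1/2}\le c_2\sqrt{\frac{s\log p}{n}}$$ and, with $\tau=c_2\sqrt{s\log p/n}$, $$\mathrm{sign}(\hat L^\tau_{ij})=\mathrm{sign}(L_{ij})\qquad\text{for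 all } i\neq j.$$ -/

import Mathlib

open MeasureTheory ProbabilityTheory Filter Topology Matrix

noncomputable section

namespace CSCS

/-- Lower triangular real `p × p` matrices with positive diagonal entries. -/
def lowerPos (p : ℕ) : Set (Matrix (Fin p) (Fin p) ℝ) :=
  {L | (∀ i j, i < j → L i j = 0) ∧ ∀ i, 0 < L i i}

/-- The covariance matrix `(I - B)⁻¹ Λ (I - B)⁻ᵀ`, `Λ = diag v`, of a vector that follows the linear
structural equation model `x = B x + e` with uncorrelated errors of variances `v`. -/
def semCov {p : ℕ} (B : Matrix (Fin p) (Fin p) ℝ) (v : Fin p → ℝ) : Matrix (Fin p) (Fin p) ℝ :=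
  (1 - B)⁻¹ * Matrix.diagonal v * ((1 - B)⁻¹)ᵀ

/-- `L` is the Cholesky factor of the precision matrix `Sigma⁻¹ = Lᵀ L`. -/
def IsCholeskyFactor {p : ℕ} (Sigma L : Matrix (Fin p) (Fin p) ℝ) : Prop :=
  L ∈ lowerPos p ∧ Lᵀ * L = Sigma⁻¹

/-- `X k j` (`k` the observation, `j` the variable) is a sample of `n` independent, identically
distributed rows from the linear structural equation model `x = B x + e`, the variables being
listed in a topological order (`B` strictly lower triangular), with independent mean-zero errors
`e j` of variances `v j > 0`. -/
structure IsLinearSEMSample {Ω : Type*} [MeasurableSpace Ω] (μ : Measure Ω) {n p : ℕ}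
    (B : Matrix (Fin p) (Fin p) ℝ) (v : Fin p → ℝ)
    (X e : Fin n → Fin p → Ω → ℝ) : Prop where
  strictLower : ∀ i j, i ≤ j → B i j = 0
  var_pos : ∀ j, 0 < v j
  measurable_obs : ∀ k j, Measurable (X k j)
  measurable_err : ∀ k j, Measurable (e k j)
  equation : ∀ k j, ∀ᵐ ω ∂μ, X k j ω = ∑ l, B j l * X k l ω + e k j ω
  indep : iIndepFun (fun kj : Fin n × Fin p => e kj.1 kj.2) μ
  identDistrib : ∀ k l j, IdentDistrib (e k j) (e l j) μ μ
  memLp : ∀ k j, MemLp (e k j) 2 μ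
  mean_zero : ∀ k j, ∫ ω, e k j ω ∂μ = 0
  variance_eq : ∀ k j, Var[e k j; μ] = v j

/-- Sub-Gaussian marginals: `E exp (t X_j / √Σ_jj) ≤ exp (C t²)` for all real `t` and all `j`. -/
def SubGaussianMarginals {Ω : Type*} [MeasurableSpace Ω] (μ : Measure Ω) {n p : ℕ}
    (Sigma : Matrix (Fin p) (Fin p) ℝ) (C : ℝ) (X : Fin n → Fin p → Ω → ℝ) : Prop :=
  ∀ k j, ∀ t : ℝ,
    Integrable (fun ω => Real.exp (t * (X k j ω / √(Sigma j j)))) μ ∧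
    ∫ ω, Real.exp (t * (X k j ω / √(Sigma j j))) ∂μ ≤ Real.exp (C * t ^ 2)

/-- The number of nonzero off-diagonal entries. -/
def sparsity {p : ℕ} (L : Matrix (Fin p) (Fin p) ℝ) : ℕ :=
  Set.ncard {ij : Fin p × Fin p | ij.1 ≠ ij.2 ∧ L ij.1 ij.2 ≠ 0}

/-- All singular values of `L` lie in `[κ⁻¹, κ]`: `κ⁻¹ ‖x‖ ≤ ‖L x‖ ≤ κ ‖x‖` for all `x`, in the
Euclidean norm. -/
def SingularValuesIn {p : ℕ} (κ : ℝ) (L : Matrix (Fin p) (Fin p) ℝ) : Prop :=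
  ∀ x : Fin p → ℝ, κ⁻¹ * ‖WithLp.toLp 2 x‖ ≤ ‖WithLp.toLp 2 (L *ᵥ x)‖ ∧
    ‖WithLp.toLp 2 (L *ᵥ x)‖ ≤ κ * ‖WithLp.toLp 2 x‖

/-- Every nonzero off-diagonal entry of `L` exceeds `ℓ` in absolute value. -/
def MinStrength {p : ℕ} (ℓ : ℝ) (L : Matrix (Fin p) (Fin p) ℝ) : Prop :=
  ∀ i j, i ≠ j → L i j ≠ 0 → ℓ < |L i j|

/-- The rate `√(m log p / n)`. -/
def rate (m p n : ℕ) : ℝ := √((m : ℝ) * Real.log p / n)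

/-- The sample covariance matrix `n⁻¹ ∑ₖ xₖ xₖᵀ` of `n` observations of a mean-zero vector. -/
def sampleCov {n p : ℕ} (x : Fin n → Fin p → ℝ) : Matrix (Fin p) (Fin p) ℝ :=
  Matrix.of fun i j => (n : ℝ)⁻¹ * ∑ k, x k i * x k j

/-- The objective `tr (Lᵀ L S) - 2 log |L| + lam ∑_{j < i} |L_ij|`. -/
def objective {p : ℕ} (S : Matrix (Fin p) (Fin p) ℝ) (lam : ℝ) (L : Matrix (Fin p) (Fin p) ℝ) : ℝ :=
  (Lᵀ * L * S).trace - 2 * Real.log L.det + lam * ∑ i, ∑ j with j < i, |L i j|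

/-- `M` is a CSCS estimate: it minimizes the objective over the lower triangular matrices with
positive diagonal. -/
def IsEstimate {p : ℕ} (S : Matrix (Fin p) (Fin p) ℝ) (lam : ℝ) (M : Matrix (Fin p) (Fin p) ℝ) :
    Prop :=
  M ∈ lowerPos p ∧ ∀ L ∈ lowerPos p, objective S lam M ≤ objective S lam L

/-- Hard thresholding of the entries at level `τ`. -/
def threshold {p : ℕ} (τ : ℝ) (M : Matrix (Fin p) (Fin p) ℝ) : Matrix (Fin p) (Fin p) ℝ :=
  Matrix.of fun i j => if τ < |M i j| then M i j else 0

/-- The Frobenius norm of the off-diagonal part. -/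
def offDiagNorm {p : ℕ} (M : Matrix (Fin p) (Fin p) ℝ) : ℝ :=
  √(∑ i, ∑ j with j ≠ i, M i j ^ 2)

/-- The events `E n` hold with probability tending to one. It is the outer probability of the
complement that tends to zero, so that the measurability of `E n` is not an issue. -/
def WithProbTendingToOne {Ω : ℕ → Type*} [∀ n, MeasurableSpace (Ω n)] (μ : ∀ n, Measure (Ω n))
    (E : ∀ n, Set (Ω n)) : Prop :=
  Tendsto (fun n => μ n (E n)ᶜ) atTop (𝓝 0)

end CSCS

end

/-! ### Independence of rows, and Bernstein's inequality for squares of sub-Gaussian variables. -/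

namespace CSCS

/-! Since the determinant of a triangular matrix is the product of its diagonal, the objective is a
sum of separate problems for the rows (`objective_eq_sum`). Row `i` of the true factor solves the
population score equation: `Sigma * Lᵀ = L⁻¹` is lower triangular, so on the coordinates `j ≤ i` the
vector `Sigma *ᵥ L i` is `(L i i)⁻¹` at `i` and zero elsewhere (`IsCholeskyFactor.mulVec_row`).
Sampling error therefore enters in two ways only: through `S - Sigma` as a quadratic form, which
must leave `S` bounded below by `κ⁻² / 2`, and through the score errors `(S - Sigma) *ᵥ L i`, whose
entries must not exceed `lam / 4`.

Given these two bounds the rest is deterministic. The basic inequality of the lasso bounds the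
squared error of a row with `sᵢ` off-diagonal entries by a multiple of `lam² (sᵢ + 1)`
(`row_error_le`); the `1` stands for the unpenalized diagonal. Summed over the rows this gives only
`s + p`. To reach `s`, a row with `sᵢ = 0` is shown to be estimated without any off-diagonal error
(`row_eq_zero`), while `sᵢ + 1 ≤ 2 sᵢ` in the other rows; `offDiagNorm_le` combines the two cases.

For the probability, each error `e j` is a summand of `X j` independent of the mean-zero rest, so it
inherits the sub-Gaussian bound. Linear forms `u ⬝ᵥ X` are then sub-Gaussian with proxy proportional
to `u ⬝ᵥ u`, and their squares obey Bernstein's inequality. A union bound over an integer grid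
controls the quadratic form; its `exp (O(p log p))` points are affordable because `p log p = o(n)`.
Polarization and a union bound over `p²` pairs control the score at level `√(log p / n)`. Signs
follow because the Frobenius error dominates every entry. -/

theorem iIndepFun_curry {Ω ι κ : Type*} {mΩ : MeasurableSpace Ω} {P : Measure Ω}
    {X : ι → κ → Ω → ℝ} (mX : ∀ i j, Measurable (X i j))
    (h : iIndepFun (fun ij : ι × κ => X ij.1 ij.2) P) :
    iIndepFun (fun i ω j => X i j ω) P := by
  have hP := h.isProbabilityMeasure
  have hprob : ∀ i j, IsProbabilityMeasure (P.map (X i j)) :=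
    fun i j ↦ Measure.isProbabilityMeasure_map (mX i j).aemeasurable
  have hσ : iIndepFun (fun (p : (_ : ι) × κ) ω ↦ X p.1 p.2 ω) P :=
    h.precomp (g := fun p : (_ : ι) × κ => (p.1, p.2)) (Equiv.sigmaEquivProd ι κ).injective
  have hrow : ∀ i, iIndepFun (X i) P := fun i =>
    h.precomp (g := fun j : κ => (i, j)) (Prod.mk_right_injective i)
  have hm : ∀ i, Measurable fun ω j => X i j ω := fun i => by fun_prop
  have hc : (MeasurableEquiv.piCurry (fun (_ : ι) (_ : κ) => ℝ)) ∘
      (fun ω (p : (_ : ι) × κ) ↦ X p.1 p.2 ω) = fun ω i j ↦ X i j ω := by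
    ext; simp [Sigma.curry]
  rw [iIndepFun_iff_map_fun_eq_infinitePi_map hm, ← hc,
    ← Measure.map_map (by fun_prop) (by fun_prop),
    (iIndepFun_iff_map_fun_eq_infinitePi_map (by fun_prop)).1 hσ,
    Measure.infinitePi_map_piCurry (fun i j ↦ P.map (X i j))]
  congrm Measure.infinitePi fun i ↦ ?_
  rw [(iIndepFun_iff_map_fun_eq_infinitePi_map (by fun_prop)).1 (hrow i)]

/-- `exp (y² / (4c))` is a Gaussian mixture of the functions `exp (g y)`. -/
theorem lintegral_exp_mul_gaussianReal (v : NNReal) (y : ℝ) :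
    ∫⁻ g, ENNReal.ofReal (Real.exp (g * y)) ∂(gaussianReal 0 v) =
      ENNReal.ofReal (Real.exp (v * y ^ 2 / 2)) := by
  have h := congrFun (mgf_id_gaussianReal (μ := 0) (v := v)) y
  have hi : Integrable (fun x ↦ Real.exp (y * x)) (gaussianReal 0 v) :=
    integrable_exp_mul_gaussianReal y
  rw [zero_mul, zero_add, mgf] at h
  simp only [id_eq] at h
  rw [← h, ofReal_integral_eq_lintegral_ofReal hi (ae_of_all _ fun _ => (Real.exp_pos _).le)]
  simp [mul_comm]

/-- The density is proportional to `exp (-c g²)`, so the integrand only halves the exponent and the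
integral is `√2`. -/
theorem lintegral_exp_sq_gaussianReal {c : NNReal} (hc : 0 < c) :
    ∫⁻ g, ENNReal.ofReal (Real.exp (c * g ^ 2 / 2)) ∂(gaussianReal 0 (1 / (2 * c))) ≤ 2 := by
  have hc' : (0 : ℝ) < c := hc
  have hv : (1 / (2 * c) : NNReal) ≠ 0 := by positivity
  rw [gaussianReal_of_var_ne_zero _ hv,
    lintegral_withDensity_eq_lintegral_mul _ (by fun_prop) (by fun_prop)]
  have he : ∀ g : ℝ, (gaussianPDF 0 (1 / (2 * c)) * fun g : ℝ =>
      ENNReal.ofReal (Real.exp (c * g ^ 2 / 2))) g =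
      ENNReal.ofReal ((√(Real.pi / c))⁻¹ * Real.exp (-(c / 2) * g ^ 2)) := by
    intro g
    rw [Pi.mul_apply, gaussianPDF, ← ENNReal.ofReal_mul (gaussianPDFReal_nonneg _ _ _),
      gaussianPDFReal, mul_assoc, ← Real.exp_add]
    congr 3
    · congr 1
      push_cast
      field_simp
    · push_cast
      field_simp
      ring
  simp_rw [he]
  rw [← ofReal_integral_eq_lintegral_ofReal]
  · rw [integral_const_mul, integral_gaussian]
    have : (√(Real.pi / c))⁻¹ * √(Real.pi / (c / 2)) = √2 := by
      rw [← Real.sqrt_inv, ← Real.sqrt_mul (by positivity)]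
      congr 1
      field_simp
    rw [this, ENNReal.ofReal_le_iff_le_toReal (by simp)]
    simp only [ENNReal.toReal_ofNat]
    rw [Real.sqrt_le_left (by norm_num)]
    norm_num
  · exact (integrable_exp_neg_mul_sq (by positivity)).const_mul _
  · exact ae_of_all _ fun _ => by positivity

section SubGaussian

variable {Ω : Type*} {mΩ : MeasurableSpace Ω} {μ : Measure Ω} {Y : Ω → ℝ} {c : NNReal}

/-- After writing the exponential of the square as a Gaussian mixture of `exp (g Y)`, Tonelli's
theorem lets the sub-Gaussian bound be applied for each fixed `g`. -/
theorem lintegral_exp_sq_le [IsProbabilityMeasure μ] (hY : HasSubgaussianMGF Y c μ)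
    (hm : Measurable Y) (hc : 0 < c) :
    ∫⁻ ω, ENNReal.ofReal (Real.exp (Y ω ^ 2 / (4 * c))) ∂μ ≤ 2 := by
  have hc' : (0 : ℝ) < c := hc
  calc ∫⁻ ω, ENNReal.ofReal (Real.exp (Y ω ^ 2 / (4 * c))) ∂μ
      = ∫⁻ ω, ∫⁻ g, ENNReal.ofReal (Real.exp (g * Y ω)) ∂(gaussianReal 0 (1 / (2 * c))) ∂μ := by
        refine lintegral_congr fun ω => ?_
        rw [lintegral_exp_mul_gaussianReal]
        congr 2
        push_cast
        field_simp
        ring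
    _ = ∫⁻ g, ∫⁻ ω, ENNReal.ofReal (Real.exp (g * Y ω)) ∂μ ∂(gaussianReal 0 (1 / (2 * c))) := by
        refine lintegral_lintegral_swap ?_
        refine Measurable.aemeasurable ?_
        simp only [Function.uncurry_def]
        fun_prop
    _ ≤ ∫⁻ g, ENNReal.ofReal (Real.exp (c * g ^ 2 / 2)) ∂(gaussianReal 0 (1 / (2 * c))) := by
        refine lintegral_mono fun g => ?_
        rw [← ofReal_integral_eq_lintegral_ofReal (hY.integrable_exp_mul g)
          (ae_of_all _ fun _ => (Real.exp_pos _).le)]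
        exact ENNReal.ofReal_le_ofReal (hY.mgf_le g)
    _ ≤ 2 := lintegral_exp_sq_gaussianReal hc

theorem integrable_exp_sq [IsProbabilityMeasure μ] (hY : HasSubgaussianMGF Y c μ)
    (hm : Measurable Y) (hc : 0 < c) :
    Integrable (fun ω => Real.exp (Y ω ^ 2 / (4 * c))) μ := by
  refine ⟨by fun_prop, ?_⟩
  rw [hasFiniteIntegral_iff_ofReal (ae_of_all _ fun _ => (Real.exp_pos _).le)]
  exact (lintegral_exp_sq_le hY hm hc).trans_lt (by simp)

theorem integral_exp_sq_le [IsProbabilityMeasure μ] (hY : HasSubgaussianMGF Y c μ)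
    (hm : Measurable Y) (hc : 0 < c) :
    ∫ ω, Real.exp (Y ω ^ 2 / (4 * c)) ∂μ ≤ 2 := by
  have h := lintegral_exp_sq_le hY hm hc
  rw [← ofReal_integral_eq_lintegral_ofReal (integrable_exp_sq hY hm hc)
    (ae_of_all _ fun _ => (Real.exp_pos _).le)] at h
  have h2 := ENNReal.toReal_mono (by simp) h
  rwa [ENNReal.toReal_ofReal (integral_nonneg fun _ => (Real.exp_pos _).le),
    ENNReal.toReal_ofNat] at h2

theorem exp_le_one_add_add_sq_mul (x : ℝ) : Real.exp x ≤ 1 + x + x ^ 2 * Real.exp |x| := by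
  rcases le_or_gt |x| 1 with h | h
  · have h1 := (abs_le.1 (Real.abs_exp_sub_one_sub_id_le h)).2
    have h2 : x ^ 2 * 1 ≤ x ^ 2 * Real.exp |x| :=
      mul_le_mul_of_nonneg_left (Real.one_le_exp (abs_nonneg x)) (sq_nonneg x)
    linarith
  · rcases le_or_gt 0 x with h0 | h0
    · rw [abs_of_nonneg h0] at h ⊢
      nlinarith [Real.exp_pos x, mul_pos (Real.exp_pos x) (by linarith : 0 < x - 1)]
    · have h2 : x ^ 2 * 1 ≤ x ^ 2 * Real.exp |x| :=
        mul_le_mul_of_nonneg_left (Real.one_le_exp (abs_nonneg x)) (sq_nonneg x)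
      rw [abs_of_neg h0] at h
      have := Real.exp_le_one_iff.2 h0.le
      nlinarith

/-- The second-order remainder is paid by one exponential moment: both `y² / 8` and `exp |θ y|` are
at most `exp (|y| / 2)`. -/
theorem exp_mul_le {θ : ℝ} (hθ : |θ| ≤ 1 / 2) (y : ℝ) :
    Real.exp (θ * y) ≤ 1 + θ * y + 8 * θ ^ 2 * Real.exp |y| := by
  have h1 := exp_le_one_add_add_sq_mul (θ * y)
  have h2 : Real.exp |θ * y| ≤ Real.exp (|y| / 2) := by
    refine Real.exp_le_exp.2 ?_
    rw [abs_mul]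
    nlinarith [abs_nonneg y]
  have h3 : y ^ 2 ≤ 8 * Real.exp (|y| / 2) := by
    have := Real.quadratic_le_exp_of_nonneg (by positivity : 0 ≤ |y| / 2)
    have h4 := sq_abs y
    nlinarith [abs_nonneg y]
  have h5 : Real.exp |y| = Real.exp (|y| / 2) * Real.exp (|y| / 2) := by
    rw [← Real.exp_add]; ring_nf
  have h6 : (θ * y) ^ 2 * Real.exp |θ * y| ≤
      θ ^ 2 * (8 * Real.exp (|y| / 2)) * Real.exp (|y| / 2) := by
    rw [mul_pow]
    gcongr
  rw [h5]
  nlinarith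

/-- The centred square of a sub-Gaussian variable is sub-exponential. -/
theorem mgf_centered_sq [IsProbabilityMeasure μ] (hY : HasSubgaussianMGF Y c μ)
    (hm : Measurable Y) (hc : 0 < c)
    {s : ℝ} (hs : |s| ≤ 1 / (8 * c)) :
    Integrable (fun ω => Real.exp (s * (Y ω ^ 2 - ∫ ω, Y ω ^ 2 ∂μ))) μ ∧
    mgf (fun ω => Y ω ^ 2 - ∫ ω, Y ω ^ 2 ∂μ) μ s ≤ Real.exp (512 * c ^ 2 * s ^ 2) := by
  have hc' : (0 : ℝ) < c := hc
  set E := ∫ ω, Y ω ^ 2 ∂μ with hE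
  have hE0 : 0 ≤ E := integral_nonneg fun _ => sq_nonneg _
  have hI := integrable_exp_sq hY hm hc
  have hsq : Integrable (fun ω => Y ω ^ 2) μ := (hY.memLp 2).integrable_sq
  have hθ : |s * (4 * c)| ≤ 1 / 2 := by
    rw [abs_mul, abs_of_pos (by positivity : (0 : ℝ) < 4 * c)]
    calc |s| * (4 * c) ≤ 1 / (8 * c) * (4 * c) := by gcongr
      _ = 1 / 2 := by field_simp; norm_num
  -- Jensen's inequality: centering the square costs at most a factor 2 in the exponential moment.
  have hJ : Real.exp (E / (4 * c)) ≤ 2 := by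
    refine le_trans ?_ (integral_exp_sq_le hY hm hc)
    have h1 := convexOn_exp.map_integral_le (μ := μ) (f := fun ω => Y ω ^ 2 / (4 * c))
      Real.continuous_exp.continuousOn isClosed_univ (by simp) (hsq.div_const _) hI
    rwa [integral_div] at h1
  -- `exp_mul_le` with `θ = 4 c s` and `y = (Y² - E) / (4 c)`. The linear term integrates to zero,
  -- and `16 (4 c s)² * 2 = 512 c² s²`.
  have hpt : ∀ ω, Real.exp (s * (Y ω ^ 2 - E)) ≤ 1 + s * (Y ω ^ 2 - E) +
      16 * (s * (4 * c)) ^ 2 * Real.exp (Y ω ^ 2 / (4 * c)) := by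
    intro ω
    have h1 := exp_mul_le hθ ((Y ω ^ 2 - E) / (4 * c))
    have h2 : s * (4 * c) * ((Y ω ^ 2 - E) / (4 * c)) = s * (Y ω ^ 2 - E) := by field_simp
    rw [h2] at h1
    have h3 : Real.exp |(Y ω ^ 2 - E) / (4 * c)| ≤ Real.exp (Y ω ^ 2 / (4 * c)) * 2 := by
      refine le_trans ?_ (mul_le_mul_of_nonneg_left hJ (Real.exp_pos _).le)
      rw [← Real.exp_add, ← add_div, abs_div, abs_of_pos (by positivity : (0 : ℝ) < 4 * c)]
      refine Real.exp_le_exp.2 ?_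
      gcongr
      rw [abs_le]
      constructor <;> nlinarith [sq_nonneg (Y ω)]
    have h4 := mul_le_mul_of_nonneg_left h3 (by positivity : 0 ≤ 8 * (s * (4 * c)) ^ 2)
    linarith
  have hint : Integrable (fun ω => 1 + s * (Y ω ^ 2 - E) +
      16 * (s * (4 * c)) ^ 2 * Real.exp (Y ω ^ 2 / (4 * c))) μ :=
    ((integrable_const 1).add ((hsq.sub (integrable_const E)).const_mul s)).add (hI.const_mul _)
  have hint' : Integrable (fun ω => Real.exp (s * (Y ω ^ 2 - E))) μ := by
    refine hint.mono' (by fun_prop) (ae_of_all _ fun ω => ?_)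
    rw [Real.norm_eq_abs, abs_of_pos (Real.exp_pos _)]
    exact hpt ω
  refine ⟨hint', ?_⟩
  have h1 := integral_mono hint' hint hpt
  have hs1 : Integrable (fun ω => Y ω ^ 2 - E) μ := hsq.sub (integrable_const E)
  have hs2 : Integrable (fun ω => 1 + s * (Y ω ^ 2 - E)) μ :=
    (integrable_const 1).add (hs1.const_mul s)
  rw [integral_add hs2 (hI.const_mul _), integral_add (integrable_const 1) (hs1.const_mul s),
    integral_const_mul, integral_const_mul, integral_sub hsq (integrable_const E)] at h1
  simp only [integral_const, probReal_univ, smul_eq_mul, one_mul, ← hE, sub_self, mul_zero,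
    add_zero] at h1
  refine h1.trans ?_
  have h2 := mul_le_mul_of_nonneg_left (integral_exp_sq_le hY hm hc)
    (by positivity : 0 ≤ 16 * (s * (4 * c)) ^ 2)
  have h3 := Real.add_one_le_exp (512 * c ^ 2 * s ^ 2)
  nlinarith

/-- Bernstein's inequality for sums of squares of independent sub-Gaussian variables. -/
theorem measureReal_sum_sq_ge_le {n : ℕ} {Y : Fin n → Ω → ℝ} {V : ℝ} [IsProbabilityMeasure μ]
    (hind : iIndepFun Y μ)
    (hY : ∀ k, HasSubgaussianMGF (Y k) c μ) (hm : ∀ k, Measurable (Y k)) (hc : 0 < c)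
    (hV : ∀ k, ∫ ω, Y k ω ^ 2 ∂μ = V) {δ : ℝ} (hδ : 0 ≤ δ) (hδc : δ ≤ 128 * c) :
    μ.real {ω | δ ≤ |(n : ℝ)⁻¹ * ∑ k, Y k ω ^ 2 - V|} ≤
      2 * Real.exp (-(n * δ ^ 2 / (2048 * c ^ 2))) := by
  have hc' : (0 : ℝ) < c := hc
  rcases Nat.eq_zero_or_pos n with hn | hn
  · subst hn
    simp only [Nat.cast_zero, zero_mul, zero_div, neg_zero, Real.exp_zero, mul_one]
    exact measureReal_le_one.trans (by norm_num)
  have hn' : (0 : ℝ) < n := by exact_mod_cast hn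
  let T : Fin n → Ω → ℝ := fun k ω => Y k ω ^ 2 - V
  have hTind : iIndepFun T μ := hind.comp (fun _ y => y ^ 2 - V) fun _ => by fun_prop
  have hTm : ∀ k, Measurable (T k) := fun k => by simp only [T]; fun_prop
  have key : ∀ s : ℝ, |s| ≤ 1 / (8 * c) → Integrable (fun ω => Real.exp (s * (∑ k, T k) ω)) μ ∧
      mgf (∑ k, T k) μ s ≤ Real.exp (n * (512 * c ^ 2 * s ^ 2)) := by
    intro s hs
    have h1 := fun k => mgf_centered_sq (hY k) (hm k) hc hs
    simp only [hV] at h1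
    refine ⟨hTind.integrable_exp_mul_sum hTm fun k _ => (h1 k).1, ?_⟩
    rw [hTind.mgf_sum hTm]
    calc ∏ k, mgf (T k) μ s ≤ ∏ k : Fin n, Real.exp (512 * c ^ 2 * s ^ 2) :=
          Finset.prod_le_prod (fun _ _ => mgf_nonneg) fun k _ => (h1 k).2
      _ = _ := by rw [Finset.prod_const, Finset.card_univ, Fintype.card_fin, ← Real.exp_nat_mul]
  -- The minimizer of the Chernoff exponent `-s δ + 512 c² s²`; the bound on `δ` is exactly what
  -- makes it admissible for `mgf_centered_sq`.
  set s := δ / (1024 * c ^ 2) with hsdef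
  have hs0 : 0 ≤ s := by positivity
  have hs : |s| ≤ 1 / (8 * c) := by
    rw [abs_of_nonneg hs0, hsdef, div_le_div_iff₀ (by positivity) (by positivity)]
    nlinarith
  have hval : -s * (n * δ) + n * (512 * c ^ 2 * s ^ 2) = -(n * δ ^ 2 / (2048 * c ^ 2)) := by
    rw [hsdef]; field_simp; ring
  have hup : μ.real {ω | n * δ ≤ (∑ k, T k) ω} ≤ Real.exp (-(n * δ ^ 2 / (2048 * c ^ 2))) := by
    refine (measure_ge_le_exp_mul_mgf (n * δ) hs0 (key s hs).1).trans ?_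
    rw [← hval, Real.exp_add]
    exact mul_le_mul_of_nonneg_left (key s hs).2 (Real.exp_pos _).le
  have hlo : μ.real {ω | (∑ k, T k) ω ≤ -(n * δ)} ≤ Real.exp (-(n * δ ^ 2 / (2048 * c ^ 2))) := by
    have hs' : |-s| ≤ 1 / (8 * c) := by rwa [abs_neg]
    refine (measure_le_le_exp_mul_mgf (-(n * δ)) (by linarith : -s ≤ 0) (key (-s) hs').1).trans ?_
    rw [← hval, Real.exp_add]
    have := (key (-s) hs').2
    rw [neg_sq] at this
    calc Real.exp (- -s * -(n * δ)) * mgf (∑ k, T k) μ (-s)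
        ≤ Real.exp (- -s * -(n * δ)) * Real.exp (n * (512 * c ^ 2 * s ^ 2)) :=
          mul_le_mul_of_nonneg_left this (Real.exp_pos _).le
      _ = _ := by ring_nf
  have hsub : {ω | δ ≤ |(n : ℝ)⁻¹ * ∑ k, Y k ω ^ 2 - V|} ⊆
      {ω | n * δ ≤ (∑ k, T k) ω} ∪ {ω | (∑ k, T k) ω ≤ -(n * δ)} := by
    intro ω hω
    have h1 : (n : ℝ)⁻¹ * ∑ k, Y k ω ^ 2 - V = (n : ℝ)⁻¹ * (∑ k, T k) ω := by
      simp only [T, Finset.sum_apply, Finset.sum_sub_distrib, Finset.sum_const, Finset.card_univ,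
        Fintype.card_fin, nsmul_eq_mul]
      field_simp
    simp only [Set.mem_ofPred_eq, h1] at hω
    rcases le_abs.1 hω with h | h
    · left
      rw [inv_mul_eq_div, le_div_iff₀ hn'] at h
      simp only [Set.mem_ofPred_eq]; linarith
    · right
      rw [inv_mul_eq_div, ← neg_div, le_div_iff₀ hn'] at h
      simp only [Set.mem_ofPred_eq]; linarith
  calc _ ≤ _ := measureReal_mono hsub
    _ ≤ _ := measureReal_union_le _ _
    _ ≤ _ := by linarith

end SubGaussian

end CSCS

/-! ### Linear algebra of the Cholesky factor. -/

namespace CSCS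

section LinearAlgebra

variable {p : ℕ}

theorem isUnit_det_of_lower {L : Matrix (Fin p) (Fin p) ℝ} (h0 : ∀ i j, i < j → L i j = 0)
    (hd : ∀ i, L i i ≠ 0) : IsUnit L.det := by
  rw [det_of_isLowerTriangular L fun i j hij => h0 i j hij]
  exact (Finset.prod_ne_zero_iff.2 fun i _ => hd i).isUnit

theorem inv_apply_eq_zero_of_lower {L : Matrix (Fin p) (Fin p) ℝ} (h0 : ∀ i j, i < j → L i j = 0)
    (hd : ∀ i, L i i ≠ 0) {i j : Fin p} (hij : i < j) : L⁻¹ i j = 0 := by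
  have := invertibleOfIsUnitDet L (isUnit_det_of_lower h0 hd)
  have hb : BlockTriangular L OrderDual.toDual := fun i j hij => h0 i j hij
  exact blockTriangular_inv_of_blockTriangular hb hij

theorem inv_apply_self_of_lower {L : Matrix (Fin p) (Fin p) ℝ} (h0 : ∀ i j, i < j → L i j = 0)
    (hd : ∀ i, L i i ≠ 0) (i : Fin p) : L⁻¹ i i = (L i i)⁻¹ := by
  have h1 : (L⁻¹ * L) i i = 1 := by
    rw [nonsing_inv_mul _ (isUnit_det_of_lower h0 hd), one_apply_eq]
  rw [mul_apply, Finset.sum_eq_single i] at h1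
  · exact eq_inv_of_mul_eq_one_left h1
  · intro j _ hj
    rcases lt_or_gt_of_ne hj with h | h
    · rw [h0 _ _ h, mul_zero]
    · rw [inv_apply_eq_zero_of_lower h0 hd h, zero_mul]
  · simp

theorem mulVec_apply (A : Matrix (Fin p) (Fin p) ℝ) (x : Fin p → ℝ) (i : Fin p) :
    (A *ᵥ x) i = ∑ j, A i j * x j := rfl

theorem dotProduct_sq_le (x y : Fin p → ℝ) : (x ⬝ᵥ y) ^ 2 ≤ (x ⬝ᵥ x) * (y ⬝ᵥ y) := by
  have := Finset.sum_mul_sq_le_sq_mul_sq Finset.univ x y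
  simpa [dotProduct, sq] using this

theorem dotProduct_self_nonneg' (x : Fin p → ℝ) : 0 ≤ x ⬝ᵥ x :=
  Finset.sum_nonneg fun i _ => mul_self_nonneg (x i)

theorem sq_apply_le_dotProduct_self (x : Fin p → ℝ) (i : Fin p) : x i ^ 2 ≤ x ⬝ᵥ x := by
  rw [sq]
  exact Finset.single_le_sum (f := fun i => x i * x i) (fun i _ => mul_self_nonneg (x i))
    (Finset.mem_univ i)

theorem norm_toLp_sq (x : Fin p → ℝ) : ‖WithLp.toLp 2 x‖ ^ 2 = x ⬝ᵥ x := by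
  rw [EuclideanSpace.norm_sq_eq]
  simp [dotProduct, sq]

variable {κ : ℝ} {Sigma L : Matrix (Fin p) (Fin p) ℝ}

theorem SingularValuesIn.sq_le (h : SingularValuesIn κ L) (x : Fin p → ℝ) :
    (L *ᵥ x) ⬝ᵥ (L *ᵥ x) ≤ κ ^ 2 * (x ⬝ᵥ x) := by
  rw [← norm_toLp_sq, ← norm_toLp_sq, ← mul_pow]
  exact pow_le_pow_left₀ (norm_nonneg _) (h x).2 2

theorem SingularValuesIn.le_sq (h : SingularValuesIn κ L) (hκ : 0 < κ) (x : Fin p → ℝ) :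
    x ⬝ᵥ x ≤ κ ^ 2 * ((L *ᵥ x) ⬝ᵥ (L *ᵥ x)) := by
  rw [← norm_toLp_sq, ← norm_toLp_sq, ← mul_pow]
  refine pow_le_pow_left₀ (norm_nonneg _) ?_ 2
  rw [← inv_mul_le_iff₀ hκ]
  exact (h x).1

theorem IsCholeskyFactor.isUnit_det (h : IsCholeskyFactor Sigma L) : IsUnit L.det :=
  isUnit_det_of_lower h.1.1 fun i => (h.1.2 i).ne'

theorem IsCholeskyFactor.eq_inv (h : IsCholeskyFactor Sigma L) : Sigma = (Lᵀ * L)⁻¹ := by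
  have hu : IsUnit Sigma.det := by
    rw [← isUnit_nonsing_inv_det_iff, ← h.2, det_mul, det_transpose]
    exact h.isUnit_det.mul h.isUnit_det
  rw [h.2, nonsing_inv_nonsing_inv _ hu]

theorem IsCholeskyFactor.mul_transpose (h : IsCholeskyFactor Sigma L) : Sigma * Lᵀ = L⁻¹ := by
  have hT : IsUnit Lᵀ.det := by rw [det_transpose]; exact h.isUnit_det
  rw [h.eq_inv, Matrix.mul_inv_rev, Matrix.mul_assoc, nonsing_inv_mul _ hT, Matrix.mul_one]

theorem IsCholeskyFactor.gram_mul (h : IsCholeskyFactor Sigma L) : Lᵀ * L * Sigma = 1 := by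
  rw [h.eq_inv]
  refine mul_nonsing_inv _ ?_
  rw [det_mul, det_transpose]
  exact h.isUnit_det.mul h.isUnit_det

/-- This is the stationarity condition of row `i` of the population objective without penalty. It
holds because `Sigma * Lᵀ = L⁻¹` is lower triangular with diagonal `(L i i)⁻¹`. -/
theorem IsCholeskyFactor.mulVec_row (h : IsCholeskyFactor Sigma L) {i j : Fin p} (hji : j ≤ i) :
    (Sigma *ᵥ L i) j = if j = i then (L i i)⁻¹ else 0 := by
  have h1 : (Sigma *ᵥ L i) j = (Sigma * Lᵀ) j i := rfl
  rw [h1, h.mul_transpose]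
  split_ifs with hj
  · subst hj
    exact inv_apply_self_of_lower h.1.1 (fun i => (h.1.2 i).ne') j
  · exact inv_apply_eq_zero_of_lower h.1.1 (fun i => (h.1.2 i).ne') (lt_of_le_of_ne hji hj)

theorem IsCholeskyFactor.quad_eq (h : IsCholeskyFactor Sigma L) (u : Fin p → ℝ) :
    u ⬝ᵥ Sigma *ᵥ u = (L *ᵥ (Sigma *ᵥ u)) ⬝ᵥ (L *ᵥ (Sigma *ᵥ u)) := by
  have h1 : u = Lᵀ *ᵥ (L *ᵥ (Sigma *ᵥ u)) := by
    rw [mulVec_mulVec, mulVec_mulVec, h.gram_mul, one_mulVec]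
  generalize hx : Sigma *ᵥ u = x at h1 ⊢
  rw [h1, mulVec_transpose, ← dotProduct_mulVec]

theorem IsCholeskyFactor.quad_le (h : IsCholeskyFactor Sigma L) (hL : SingularValuesIn κ L)
    (hκ : 0 < κ) (u : Fin p → ℝ) : u ⬝ᵥ Sigma *ᵥ u ≤ κ ^ 2 * (u ⬝ᵥ u) := by
  have h1 := dotProduct_sq_le u (Sigma *ᵥ u)
  have h2 := hL.le_sq hκ (Sigma *ᵥ u)
  rw [← h.quad_eq] at h2
  set q := u ⬝ᵥ Sigma *ᵥ u with hq
  have hq0 : 0 ≤ q := by rw [hq, h.quad_eq]; exact dotProduct_self_nonneg' _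
  have hu := dotProduct_self_nonneg' u
  rcases hq0.eq_or_lt with h0 | h0
  · rw [← h0]; positivity
  · refine le_of_mul_le_mul_right ?_ h0
    nlinarith [mul_le_mul_of_nonneg_left h2 hu]

/-- Cauchy–Schwarz for `L *ᵥ u` and `L *ᵥ (Sigma *ᵥ u)`, whose inner product is `u ⬝ᵥ u` because `Lᵀ
* L * Sigma = 1`. -/
theorem IsCholeskyFactor.le_quad (h : IsCholeskyFactor Sigma L) (hL : SingularValuesIn κ L)
    (hκ : 0 < κ) (u : Fin p → ℝ) : u ⬝ᵥ u ≤ κ ^ 2 * (u ⬝ᵥ Sigma *ᵥ u) := by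
  have h1 := dotProduct_sq_le (L *ᵥ u) (L *ᵥ (Sigma *ᵥ u))
  have h2 : (L *ᵥ u) ⬝ᵥ (L *ᵥ (Sigma *ᵥ u)) = u ⬝ᵥ u := by
    rw [← vecMul_transpose, ← dotProduct_mulVec, mulVec_mulVec, mulVec_mulVec, h.gram_mul,
      one_mulVec]
  rw [h2, ← h.quad_eq] at h1
  have h3 := hL.sq_le u
  set q := u ⬝ᵥ Sigma *ᵥ u with hq
  have hq0 : 0 ≤ q := by rw [hq, h.quad_eq]; exact dotProduct_self_nonneg' _
  rcases (dotProduct_self_nonneg' u).eq_or_lt with h0 | h0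
  · rw [← h0]; positivity
  · refine le_of_mul_le_mul_right ?_ h0
    nlinarith [mul_le_mul_of_nonneg_right h3 hq0]

/-- The rows of `L` are normalized by `Sigma`: the matrix `L * Sigma * Lᵀ` is the identity. -/
theorem IsCholeskyFactor.row_le (h : IsCholeskyFactor Sigma L) (hL : SingularValuesIn κ L)
    (hκ : 0 < κ) (i : Fin p) : L i ⬝ᵥ L i ≤ κ ^ 2 := by
  have h1 := h.le_quad hL hκ (L i)
  have h2 : L i ⬝ᵥ Sigma *ᵥ L i = (L * (Sigma * Lᵀ)) i i := rfl
  rw [h2, h.mul_transpose, mul_nonsing_inv _ h.isUnit_det, one_apply_eq, mul_one] at h1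
  exact h1

theorem IsCholeskyFactor.inv_le_diag (h : IsCholeskyFactor Sigma L) (hL : SingularValuesIn κ L)
    (hκ : 0 < κ) (i : Fin p) : κ⁻¹ ≤ L i i := by
  have h1 := hL.le_sq hκ (L⁻¹ *ᵥ Pi.single i 1)
  rw [mulVec_mulVec, mul_nonsing_inv _ h.isUnit_det, one_mulVec] at h1
  have h2 := sq_apply_le_dotProduct_self (L⁻¹ *ᵥ Pi.single i 1) i
  have h3 : (L⁻¹ *ᵥ Pi.single i 1) i = (L i i)⁻¹ := by
    rw [mulVec_single_one]
    exact inv_apply_self_of_lower h.1.1 (fun i => (h.1.2 i).ne') i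
  simp only [h3, dotProduct_single, Pi.single_eq_same, mul_one] at h1 h2
  have h4 := (sq_le_sq₀ (inv_pos.2 (h.1.2 i)).le hκ.le).1 (h2.trans h1)
  exact inv_le_of_inv_le₀ (h.1.2 i) h4

end LinearAlgebra

/-! ### Sub-Gaussian linear forms of the structural equation model. -/

section Model

variable {p n : ℕ} {B : Matrix (Fin p) (Fin p) ℝ} {v : Fin p → ℝ}

theorem semCov_quad (B : Matrix (Fin p) (Fin p) ℝ) (v : Fin p → ℝ) (u : Fin p → ℝ) :
    u ⬝ᵥ semCov B v *ᵥ u = ∑ j, (u ᵥ* (1 - B)⁻¹) j ^ 2 * v j := by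
  rw [semCov, ← mulVec_mulVec, ← mulVec_mulVec, dotProduct_mulVec, mulVec_transpose]
  simp only [dotProduct, mulVec_diagonal]
  exact Finset.sum_congr rfl fun j _ => by ring

variable {Ω : Type*} {mΩ : MeasurableSpace Ω} {μ : Measure Ω} {X e : Fin n → Fin p → Ω → ℝ}

namespace IsLinearSEMSample

theorem one_sub_lower (h : IsLinearSEMSample μ B v X e) (i j : Fin p) (hij : i < j) :
    (1 - B) i j = 0 := by
  simp [h.strictLower i j hij.le, hij.ne]

theorem one_sub_diag (h : IsLinearSEMSample μ B v X e) (i : Fin p) : (1 - B) i i = 1 := by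
  simp [h.strictLower i i le_rfl]

theorem isUnit_det (h : IsLinearSEMSample μ B v X e) : IsUnit (1 - B).det :=
  isUnit_det_of_lower h.one_sub_lower fun i => by simp [h.strictLower i i le_rfl]

theorem inv_diag (h : IsLinearSEMSample μ B v X e) (i : Fin p) : (1 - B)⁻¹ i i = 1 := by
  rw [inv_apply_self_of_lower h.one_sub_lower fun i => by rw [h.one_sub_diag]; exact one_ne_zero,
    h.one_sub_diag, inv_one]

theorem ae_eq (h : IsLinearSEMSample μ B v X e) (k : Fin n) :
    ∀ᵐ ω ∂μ, (fun j => X k j ω) = (1 - B)⁻¹ *ᵥ (fun j => e k j ω) := by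
  have h1 : ∀ᵐ ω ∂μ, ∀ j, X k j ω = ∑ l, B j l * X k l ω + e k j ω :=
    ae_all_iff.2 fun j => h.equation k j
  filter_upwards [h1] with ω hω
  have h2 : (fun j => e k j ω) = (1 - B) *ᵥ (fun j => X k j ω) := by
    funext j
    rw [sub_mulVec, one_mulVec, Pi.sub_apply]
    have := hω j
    simp only [mulVec, dotProduct]
    linarith
  rw [h2, mulVec_mulVec, nonsing_inv_mul _ h.isUnit_det, one_mulVec]

theorem ae_dotProduct_eq (h : IsLinearSEMSample μ B v X e) (u : Fin p → ℝ) (k : Fin n) :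
    (fun ω => u ⬝ᵥ fun j => X k j ω) =ᵐ[μ] fun ω => ∑ j, (u ᵥ* (1 - B)⁻¹) j * e k j ω := by
  filter_upwards [h.ae_eq k] with ω hω
  rw [hω, dotProduct_mulVec]
  rfl

theorem iIndepFun_row (h : IsLinearSEMSample μ B v X e) (k : Fin n) : iIndepFun (e k) μ :=
  h.indep.precomp (g := fun j => (k, j)) (Prod.mk_right_injective k)

theorem iIndepFun_mul (h : IsLinearSEMSample μ B v X e) (a : Fin p → ℝ) (k : Fin n) :
    iIndepFun (fun j ω => a j * e k j ω) μ :=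
  (h.iIndepFun_row k).comp (fun j y => a j * y) fun _ => by fun_prop

theorem semCov_diag (h : IsLinearSEMSample μ B v X e) (j : Fin p) : 0 < semCov B v j j := by
  have h1 := semCov_quad B v (Pi.single j 1)
  rw [mulVec_single_one, single_dotProduct, one_mul, single_one_vecMul] at h1
  change semCov B v j j = _ at h1
  rw [h1]
  refine (mul_pos (pow_pos one_pos 2) (h.var_pos j)).trans_le ?_
  have h2 := Finset.single_le_sum (f := fun l => (1 - B)⁻¹ j l ^ 2 * v l)
    (fun l _ => mul_nonneg (sq_nonneg _) (h.var_pos l).le) (Finset.mem_univ j)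
  simp only [h.inv_diag] at h2
  exact h2

/-- The errors inherit the sub-Gaussian bound of the observed variables. -/
theorem hasSubgaussianMGF_err [IsProbabilityMeasure μ] (h : IsLinearSEMSample μ B v X e) {C : ℝ}
    (hC : 0 ≤ C) (hX : SubGaussianMarginals μ (semCov B v) C X) (k : Fin n) (j : Fin p) :
    HasSubgaussianMGF (e k j) (2 * C * semCov B v j j).toNNReal μ := by
  have hS := h.semCov_diag j
  obtain ⟨W, hW⟩ : ∃ W : Matrix (Fin p) (Fin p) ℝ, W = (1 - B)⁻¹ := ⟨_, rfl⟩
  have hWj : W j j = 1 := by rw [hW, h.inv_diag]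
  have hXe : X k j =ᵐ[μ] fun ω => e k j ω + ∑ l ∈ Finset.univ.erase j, W j l * e k l ω := by
    filter_upwards [h.ae_eq k] with ω hω
    have := congrFun hω j
    rw [this, ← hW, mulVec_apply, ← Finset.add_sum_erase _ _ (Finset.mem_univ j), hWj, one_mul]
  set R : Ω → ℝ := fun ω => ∑ l ∈ Finset.univ.erase j, W j l * e k l ω with hR
  have hRm : Measurable R := by
    have := h.measurable_err
    simp only [hR]; fun_prop
  have hRi : Integrable R μ :=
    integrable_finsetSum _ fun l _ => ((h.memLp k l).integrable (by norm_num)).const_mul _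
  have hR0 : ∫ ω, R ω ∂μ = 0 := by
    rw [hR, integral_finsetSum _ fun l _ =>
      ((h.memLp k l).integrable (by norm_num)).const_mul _]
    exact Finset.sum_eq_zero fun l _ => by rw [integral_const_mul, h.mean_zero, mul_zero]
  have hind : IndepFun (e k j) R μ := by
    have h1 :=
      (h.iIndepFun_mul (fun l => if l = j then 1 else W j l) k).indepFun_finsetSum_of_notMem
      (fun l => (h.measurable_err k l).const_mul _) (Finset.notMem_erase j Finset.univ)
    have h2 : (∑ l ∈ Finset.univ.erase j, fun ω => (if l = j then 1 else W j l) * e k l ω) = R := by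
      funext ω
      rw [Finset.sum_apply]
      refine Finset.sum_congr rfl fun l hl => ?_
      rw [if_neg (Finset.ne_of_mem_erase hl)]
    rw [h2] at h1
    simpa using h1.symm
  have hmain : ∀ t : ℝ, Integrable (fun ω => Real.exp (t * e k j ω)) μ ∧
      mgf (e k j) μ t ≤ Real.exp (C * semCov B v j j * t ^ 2) := by
    intro t
    obtain ⟨h1, h2⟩ := hX k j (t * √(semCov B v j j))
    have hs : √(semCov B v j j) ≠ 0 := (Real.sqrt_pos.2 hS).ne'
    have hsim : ∀ ω, t * √(semCov B v j j) * (X k j ω / √(semCov B v j j)) = t * X k j ω := by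
      intro ω; field_simp
    simp only [hsim] at h1 h2
    rw [mul_pow, Real.sq_sqrt hS.le] at h2
    have hexp : (fun ω => Real.exp (t * X k j ω)) =ᵐ[μ]
        (fun ω => Real.exp (t * e k j ω)) * fun ω => Real.exp (t * R ω) := by
      filter_upwards [hXe] with ω hω
      rw [hω, Pi.mul_apply, ← Real.exp_add, mul_add]
    have hind' : IndepFun (fun ω => Real.exp (t * e k j ω)) (fun ω => Real.exp (t * R ω)) μ :=
      hind.comp (φ := fun y => Real.exp (t * y)) (ψ := fun y => Real.exp (t * y))
        (by fun_prop) (by fun_prop)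
    have hprod : Integrable ((fun ω => Real.exp (t * e k j ω)) * fun ω => Real.exp (t * R ω)) μ :=
      h1.congr hexp
    have hme := h.measurable_err k j
    have hne : ∀ Z : Ω → ℝ, ¬ (fun ω => Real.exp (Z ω)) =ᵐ[μ] 0 := by
      intro Z hZ
      obtain ⟨ω, hω⟩ := hZ.exists
      exact (Real.exp_pos _).ne' hω
    -- Integrability of a product of independent factors passes to each factor, since the other is
    -- not almost everywhere zero.
    have hi1 : Integrable (fun ω => Real.exp (t * e k j ω)) μ :=
      hind'.integrable_left_of_integrable_op (· * ·) 1 one_ne_zero (by simp [enorm_mul]) hprod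
        (by fun_prop) (by fun_prop) (hne _)
    have hi2 : Integrable (fun ω => Real.exp (t * R ω)) μ :=
      hind'.integrable_right_of_integrable_op (· * ·) 1 one_ne_zero (by simp [enorm_mul]) hprod
        (by fun_prop) (by fun_prop) (hne _)
    refine ⟨hi1, ?_⟩
    have h3 : ∫ ω, Real.exp (t * X k j ω) ∂μ =
        (∫ ω, Real.exp (t * e k j ω) ∂μ) * ∫ ω, Real.exp (t * R ω) ∂μ := by
      rw [integral_congr_ae hexp]
      exact hind'.integral_mul_eq_mul_integral (by fun_prop) (by fun_prop)
    -- `R` has mean zero, so `1 + x ≤ exp x` shows that dropping the factor of `R` can only decrease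
    -- the moment generating function.
    have h4 : 1 ≤ ∫ ω, Real.exp (t * R ω) ∂μ := by
      have h5 : ∫ ω, (t * R ω + 1) ∂μ ≤ ∫ ω, Real.exp (t * R ω) ∂μ :=
        integral_mono ((hRi.const_mul t).add (integrable_const 1)) hi2
          fun ω => Real.add_one_le_exp _
      rw [integral_add (hRi.const_mul t) (integrable_const 1), integral_const_mul, hR0] at h5
      simpa using h5
    have h6 : 0 ≤ ∫ ω, Real.exp (t * e k j ω) ∂μ := integral_nonneg fun _ => (Real.exp_pos _).le
    rw [mgf]
    calc ∫ ω, Real.exp (t * e k j ω) ∂μ ≤ ∫ ω, Real.exp (t * X k j ω) ∂μ := by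
          rw [h3]; exact le_mul_of_one_le_right h6 h4
      _ ≤ _ := h2.trans_eq (by ring_nf)
  refine ⟨fun t => (hmain t).1, fun t => (hmain t).2.trans_eq ?_⟩
  rw [Real.coe_toNNReal _ (by positivity)]
  ring_nf

/-- The row `u` of `1 - B` recovers the error `e j` from the observation, so its quadratic form is
`v j`, while `u j = 1` forces `u ⬝ᵥ u ≥ 1`. -/
theorem inv_sq_le_var (h : IsLinearSEMSample μ B v X e) {κ : ℝ} {L : Matrix (Fin p) (Fin p) ℝ}
    (hκ : 0 < κ) (hL : IsCholeskyFactor (semCov B v) L) (hs : SingularValuesIn κ L) (j : Fin p) :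
    1 ≤ κ ^ 2 * v j := by
  have h1 := hL.le_quad hs hκ ((1 - B) j)
  have h2 := sq_apply_le_dotProduct_self ((1 - B) j) j
  have h3 : (1 - B) j ᵥ* (1 - B)⁻¹ = Pi.single j 1 := by
    have h4 : (1 - B) j ᵥ* (1 - B)⁻¹ = ((1 - B) * (1 - B)⁻¹) j := by
      funext l; rfl
    rw [h4, mul_nonsing_inv _ h.isUnit_det]
    funext l
    rw [one_apply, Pi.single_apply]
    simp [eq_comm]
  rw [semCov_quad, h3] at h1
  rw [h.one_sub_diag] at h2
  have h5 : ∑ l, (Pi.single j 1 : Fin p → ℝ) l ^ 2 * v l = v j := by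
    rw [Finset.sum_eq_single j] <;> simp +contextual
  rw [h5] at h1
  linarith

/-- Linear forms of an observation are sub-Gaussian. -/
theorem hasSubgaussianMGF_dotProduct [IsProbabilityMeasure μ] (h : IsLinearSEMSample μ B v X e)
    {C κ : ℝ} {L : Matrix (Fin p) (Fin p) ℝ} (hC : 0 ≤ C) (hκ : 0 < κ)
    (hX : SubGaussianMarginals μ (semCov B v) C X)
    (hL : IsCholeskyFactor (semCov B v) L) (hs : SingularValuesIn κ L) (u : Fin p → ℝ) (k : Fin n) :
    HasSubgaussianMGF (fun ω => u ⬝ᵥ fun j => X k j ω) (2 * C * κ ^ 6 * (u ⬝ᵥ u)).toNNReal μ := by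
  set a := u ᵥ* (1 - B)⁻¹ with ha
  have h1 : HasSubgaussianMGF (fun ω => ∑ j, a j * e k j ω) _ μ :=
    HasSubgaussianMGF.sum_of_iIndepFun (h.iIndepFun_mul a k) (s := Finset.univ)
      fun j _ => (h.hasSubgaussianMGF_err hC hX k j).const_mul (a j)
  have h2 := h1.congr (h.ae_dotProduct_eq u k).symm
  refine ⟨h2.integrable_exp_mul, fun t => (h2.mgf_le t).trans ?_⟩
  refine Real.exp_le_exp.2 ?_
  refine div_le_div_of_nonneg_right (mul_le_mul_of_nonneg_right ?_ (sq_nonneg t)) zero_le_two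
  simp only [NNReal.coe_sum]
  change ∑ j, a j ^ 2 * ((2 * C * semCov B v j j).toNNReal : ℝ) ≤ _
  rw [Real.coe_toNNReal _ (mul_nonneg (by positivity) (dotProduct_self_nonneg' u))]
  -- Since `Σ_jj ≤ κ² ≤ κ⁴ v j`, the proxy of each error is at most a constant times its variance.
  -- The summed proxies are then controlled by the quadratic form of `Sigma`, without any dependence
  -- on `p`.
  have h3 : ∀ j, semCov B v j j ≤ κ ^ 2 := by
    intro j
    have := hL.quad_le hs hκ (Pi.single j 1)
    rw [mulVec_single_one, single_dotProduct, one_mul, single_dotProduct, one_mul,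
      Pi.single_eq_same, mul_one] at this
    exact this
  have h4 := hL.quad_le hs hκ u
  rw [semCov_quad, ← ha] at h4
  calc ∑ j, a j ^ 2 * ((2 * C * semCov B v j j).toNNReal : ℝ)
      ≤ ∑ j, 2 * C * κ ^ 4 * (a j ^ 2 * v j) := by
        refine Finset.sum_le_sum fun j _ => ?_
        have h0 := h.semCov_diag j
        rw [Real.coe_toNNReal _ (by positivity)]
        have h5 := h.inv_sq_le_var hκ hL hs j
        have h6 : semCov B v j j ≤ κ ^ 2 * (κ ^ 2 * v j) :=
          (h3 j).trans (le_mul_of_one_le_right (by positivity) h5)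
        calc a j ^ 2 * (2 * C * semCov B v j j) ≤ a j ^ 2 * (2 * C * (κ ^ 2 * (κ ^ 2 * v j))) := by
              gcongr
          _ = _ := by ring
    _ = 2 * C * κ ^ 4 * ∑ j, a j ^ 2 * v j := by rw [Finset.mul_sum]
    _ ≤ 2 * C * κ ^ 4 * (κ ^ 2 * (u ⬝ᵥ u)) := by gcongr
    _ = _ := by ring

theorem integral_dotProduct_sq [IsProbabilityMeasure μ] (h : IsLinearSEMSample μ B v X e)
    (u : Fin p → ℝ) (k : Fin n) :
    ∫ ω, (u ⬝ᵥ fun j => X k j ω) ^ 2 ∂μ = u ⬝ᵥ semCov B v *ᵥ u := by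
  set a := u ᵥ* (1 - B)⁻¹ with ha
  have hmem : ∀ j, MemLp (fun ω => a j * e k j ω) 2 μ := fun j => (h.memLp k j).const_mul _
  have h1 : ∫ ω, (u ⬝ᵥ fun j => X k j ω) ^ 2 ∂μ = ∫ ω, (∑ j, a j * e k j ω) ^ 2 ∂μ := by
    refine integral_congr_ae ?_
    filter_upwards [h.ae_dotProduct_eq u k] with ω hω
    rw [hω]
  have h2 : ∫ ω, ∑ j, a j * e k j ω ∂μ = 0 := by
    rw [integral_finsetSum _ fun j _ => (hmem j).integrable (by norm_num)]
    exact Finset.sum_eq_zero fun l _ => by rw [integral_const_mul, h.mean_zero, mul_zero]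
  have hm := h.measurable_err
  have h3 := variance_of_integral_eq_zero (X := fun ω => ∑ j, a j * e k j ω) (μ := μ)
    (by fun_prop) h2
  rw [h1, ← h3, semCov_quad, ← ha]
  have h4 := IndepFun.variance_sum (X := fun j ω => a j * e k j ω) (μ := μ) (s := Finset.univ)
    (fun j _ => hmem j) fun i _ j _ hij => (h.iIndepFun_mul a k).indepFun hij
  have h5 : (∑ j, fun ω => a j * e k j ω) = fun ω => ∑ j, a j * e k j ω := by
    funext ω; rw [Finset.sum_apply]
  rw [h5] at h4
  rw [h4]
  exact Finset.sum_congr rfl fun j _ => by rw [variance_const_mul, h.variance_eq]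

theorem iIndepFun_dotProduct (h : IsLinearSEMSample μ B v X e) (u : Fin p → ℝ) :
    iIndepFun (fun (k : Fin n) ω => u ⬝ᵥ fun j => X k j ω) μ := by
  have h1 := iIndepFun_curry h.measurable_err h.indep
  have h2 := h1.comp (fun _ y => ∑ j, (u ᵥ* (1 - B)⁻¹) j * y j) fun _ => by fun_prop
  exact h2.congr fun k => (h.ae_dotProduct_eq u k).symm

end IsLinearSEMSample

end Model

end CSCS

/-! ### Quadratic forms controlled on an integer grid. -/

namespace CSCS

section Net

variable {p : ℕ} {A : Matrix (Fin p) (Fin p) ℝ}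

theorem dotProduct_mulVec_comm (hA : Aᵀ = A) (a b : Fin p → ℝ) : b ⬝ᵥ A *ᵥ a = a ⬝ᵥ A *ᵥ b := by
  conv_lhs => rw [dotProduct_mulVec, dotProduct_comm, ← mulVec_transpose, hA]

theorem quad_polarization (hA : Aᵀ = A) (a b : Fin p → ℝ) :
    (a + b) ⬝ᵥ A *ᵥ (a + b) - (a - b) ⬝ᵥ A *ᵥ (a - b) = 4 * (a ⬝ᵥ A *ᵥ b) := by
  have := dotProduct_mulVec_comm hA a b
  simp only [mulVec_add, mulVec_sub, dotProduct_add, dotProduct_sub, add_dotProduct, sub_dotProduct]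
  linarith

theorem abs_bilin_le (hA : Aᵀ = A) {a b : Fin p → ℝ} {s t : ℝ}
    (h1 : |(a + b) ⬝ᵥ A *ᵥ (a + b)| ≤ s) (h2 : |(a - b) ⬝ᵥ A *ᵥ (a - b)| ≤ t) :
    |a ⬝ᵥ A *ᵥ b| ≤ (s + t) / 4 := by
  have h := quad_polarization hA a b
  rw [abs_le] at *
  constructor <;> linarith [h1.1, h1.2, h2.1, h2.2]

theorem parallelogram (a b : Fin p → ℝ) :
    (a + b) ⬝ᵥ (a + b) + (a - b) ⬝ᵥ (a - b) = 2 * (a ⬝ᵥ a + b ⬝ᵥ b) := by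
  simp only [dotProduct_add, dotProduct_sub, add_dotProduct, sub_dotProduct]
  ring

theorem abs_bilin_le_sum {δ M N : ℝ} (hA : ∀ i j, |A i j| ≤ δ) {a b : Fin p → ℝ}
    (ha : ∀ i, |a i| ≤ M) (hb : ∀ i, |b i| ≤ N) (hδ : 0 ≤ δ) (hM : 0 ≤ M) :
    |a ⬝ᵥ A *ᵥ b| ≤ p * (p * (M * (δ * N))) := by
  have h1 : ∀ i j, |a i * (A i j * b j)| ≤ M * (δ * N) := by
    intro i j
    rw [abs_mul, abs_mul]
    gcongr
    exacts [ha i, hA i j, hb j]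
  have h2 : a ⬝ᵥ A *ᵥ b = ∑ i, ∑ j, a i * (A i j * b j) := by
    simp only [dotProduct, mulVec, Finset.mul_sum]
  rw [h2]
  calc |∑ i, ∑ j, a i * (A i j * b j)| ≤ ∑ i, ∑ j, |a i * (A i j * b j)| :=
        (Finset.abs_sum_le_sum_abs _ _).trans
          (Finset.sum_le_sum fun i _ => Finset.abs_sum_le_sum_abs _ _)
    _ ≤ ∑ i : Fin p, ∑ j : Fin p, M * (δ * N) :=
        Finset.sum_le_sum fun i _ => Finset.sum_le_sum fun j _ => h1 i j
    _ = _ := by simp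

/-- A quadratic form that is small on the integer points of a large cube is small everywhere. -/
theorem abs_quad_le_of_grid (hA : Aᵀ = A) {δ : ℝ} (hδ : 0 ≤ δ) {m : ℕ} (hm : 2 * p ^ 2 ≤ m)
    (hgrid : ∀ y : Fin p → ℤ, (∀ i, |y i| ≤ m) →
      |(fun i => (y i : ℝ)) ⬝ᵥ A *ᵥ fun i => (y i : ℝ)| ≤
        δ * ((fun i => (y i : ℝ)) ⬝ᵥ fun i => (y i : ℝ)))
    (x : Fin p → ℝ) : |x ⬝ᵥ A *ᵥ x| ≤ 5 * δ * (x ⬝ᵥ x) := by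
  rcases Nat.eq_zero_or_pos p with hp | hp
  · subst hp; simp [dotProduct]
  have hp1 : (1 : ℝ) ≤ p := by exact_mod_cast hp
  have hm2 : 2 * (p : ℝ) ^ 2 ≤ m := by exact_mod_cast hm
  have hm2' : 2 ≤ m := le_trans (by nlinarith) hm
  -- The grid contains `e_i ± e_j` (an entry 2 occurs when `i = j`), so polarization bounds each
  -- entry of `A`.
  have hentry : ∀ i j, |A i j| ≤ δ := by
    intro i j
    have h1 := hgrid (Pi.single i 1 + Pi.single j 1) fun l => by
      simp only [Pi.add_apply, Pi.single_apply]
      split_ifs <;> simp <;> omega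
    have h2 := hgrid (Pi.single i 1 - Pi.single j 1) fun l => by
      simp only [Pi.sub_apply, Pi.single_apply]
      split_ifs <;> simp <;> omega
    have e1 : (fun l => (((Pi.single i 1 + Pi.single j 1 : Fin p → ℤ) l : ℤ) : ℝ)) =
        Pi.single i 1 + Pi.single j 1 := by
      funext l; simp [Pi.single_apply]
    have e2 : (fun l => (((Pi.single i 1 - Pi.single j 1 : Fin p → ℤ) l : ℤ) : ℝ)) =
        Pi.single i 1 - Pi.single j 1 := by
      funext l; simp [Pi.single_apply]
    rw [e1] at h1
    rw [e2] at h2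
    have h3 := abs_bilin_le hA h1 h2
    rw [← mul_add, parallelogram] at h3
    simp only [mulVec_single_one, single_dotProduct, Pi.single_eq_same, one_mul] at h3
    change |A i j| ≤ _ at h3
    linarith
  rcases (dotProduct_self_nonneg' x).eq_or_lt with h0 | h0
  · have hx : x = 0 := dotProduct_self_eq_zero.1 h0.symm
    subst hx; simp
  -- Rescaling to Euclidean length `m` keeps the coordinates, and hence their floors, in `[-m, m]`,
  -- while the rounding error `r` has entries at most 1.
  set t : ℝ := m / √(x ⬝ᵥ x) with ht
  have hmpos : (0 : ℝ) < m := by nlinarith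
  have htpos : 0 < t := by positivity
  have ht2 : t ^ 2 * (x ⬝ᵥ x) = m ^ 2 := by
    rw [ht, div_pow, Real.sq_sqrt h0.le]; field_simp
  set z : Fin p → ℝ := t • x with hz
  have hzz : z ⬝ᵥ z = m ^ 2 := by
    rw [hz, smul_dotProduct, dotProduct_smul, ← ht2, smul_eq_mul, smul_eq_mul]; ring
  have hzm : ∀ i, |z i| ≤ m := fun i =>
    abs_le_of_sq_le_sq ((sq_apply_le_dotProduct_self z i).trans_eq hzz) hmpos.le
  set y : Fin p → ℤ := fun i => ⌊z i⌋ with hy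
  set y' : Fin p → ℝ := fun i => (y i : ℝ) with hy'
  have hym : ∀ i, |y i| ≤ m := by
    intro i
    have := abs_le.1 (hzm i)
    rw [abs_le]
    constructor
    · exact Int.le_floor.2 (by push_cast; exact this.1)
    · have h1 := (Int.floor_le (z i)).trans this.2
      exact_mod_cast h1
  set r : Fin p → ℝ := z - y' with hr
  have hr1 : ∀ i, |r i| ≤ 1 := by
    intro i
    have h1 : r i = Int.fract (z i) := rfl
    rw [h1, abs_of_nonneg (Int.fract_nonneg _)]
    exact (Int.fract_lt_one _).le
  have hq1 := hgrid y hym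
  have hrr : r ⬝ᵥ r ≤ p := by
    calc r ⬝ᵥ r ≤ ∑ i : Fin p, (1 : ℝ) := Finset.sum_le_sum fun i _ => by
          have := (sq_le_one_iff_abs_le_one (r i)).2 (hr1 i)
          nlinarith
      _ = p := by simp
  have hyy : y' ⬝ᵥ y' ≤ 4 * m ^ 2 := by
    have h1 := parallelogram z r
    have h2 : z - r = y' := by rw [hr]; abel
    have h3 := dotProduct_self_nonneg' (z + r)
    rw [h2, hzz] at h1
    have h4 : (p : ℝ) ≤ m := by nlinarith
    have h5 : (m : ℝ) ≤ m ^ 2 := by nlinarith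
    linarith
  have hq2 : |r ⬝ᵥ A *ᵥ (z + y')| ≤ p * (p * (1 * (δ * (2 * m)))) := by
    refine abs_bilin_le_sum hentry hr1 (fun i => ?_) hδ zero_le_one
    have h2 : |y' i| ≤ m := by
      have := hym i
      change |((y i : ℤ) : ℝ)| ≤ m
      exact_mod_cast this
    calc |(z + y') i| ≤ |z i| + |y' i| := abs_add_le _ _
      _ ≤ 2 * m := by linarith [hzm i]
  have hsplit : z ⬝ᵥ A *ᵥ z = y' ⬝ᵥ A *ᵥ y' + r ⬝ᵥ A *ᵥ (z + y') := by
    have := dotProduct_mulVec_comm hA z y'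
    simp only [hr, mulVec_add, dotProduct_add, sub_dotProduct]
    linarith
  -- The grid point contributes at most `4 δ m²`. The rounding contributes at most `2 p² δ m`, which
  -- is at most `δ m²` because `2 p² ≤ m`.
  have hzq : |z ⬝ᵥ A *ᵥ z| ≤ 5 * δ * m ^ 2 := by
    rw [hsplit]
    refine (abs_add_le _ _).trans ?_
    have h1 : δ * (y' ⬝ᵥ y') ≤ δ * (4 * m ^ 2) := by gcongr
    have h2 : (p : ℝ) * (p * (1 * (δ * (2 * m)))) ≤ δ * m ^ 2 := by
      have : δ * m * (2 * (p : ℝ) ^ 2) ≤ δ * m * m := by gcongr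
      nlinarith
    linarith
  have hzx : z ⬝ᵥ A *ᵥ z = t ^ 2 * (x ⬝ᵥ A *ᵥ x) := by
    rw [hz, mulVec_smul, smul_dotProduct, dotProduct_smul, smul_eq_mul, smul_eq_mul]; ring
  rw [hzx, abs_mul, abs_of_nonneg (sq_nonneg t), ← ht2] at hzq
  refine le_of_mul_le_mul_left ?_ (by positivity : 0 < t ^ 2)
  linarith

end Net

/-! ### Concentration of the sample covariance matrix. -/

section Concentration

variable {p n : ℕ} {B L : Matrix (Fin p) (Fin p) ℝ} {v : Fin p → ℝ}

theorem sampleCov_quad (x : Fin n → Fin p → ℝ) (u : Fin p → ℝ) :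
    u ⬝ᵥ sampleCov x *ᵥ u = (n : ℝ)⁻¹ * ∑ k, (u ⬝ᵥ x k) ^ 2 := by
  have h1 : sampleCov x *ᵥ u = (n : ℝ)⁻¹ • ∑ k, (u ⬝ᵥ x k) • x k := by
    funext i
    simp only [sampleCov, mulVec, dotProduct, of_apply, Pi.smul_apply, Finset.sum_apply,
      smul_eq_mul, Finset.mul_sum, Finset.sum_mul]
    rw [Finset.sum_comm]
    exact Finset.sum_congr rfl fun k _ => Finset.sum_congr rfl fun j _ => by ring
  rw [h1, dotProduct_smul, dotProduct_sum, smul_eq_mul]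
  simp only [dotProduct_smul, smul_eq_mul, sq]

theorem sampleCov_transpose (x : Fin n → Fin p → ℝ) : (sampleCov x)ᵀ = sampleCov x := by
  ext i j
  simp [sampleCov, mul_comm]

theorem semCov_transpose (B : Matrix (Fin p) (Fin p) ℝ) (v : Fin p → ℝ) :
    (semCov B v)ᵀ = semCov B v := by
  simp [semCov, Matrix.mul_assoc]

variable {Ω : Type*} {mΩ : MeasurableSpace Ω} {μ : Measure Ω} {X e : Fin n → Fin p → Ω → ℝ}

theorem measureReal_quad_deviation_le [IsProbabilityMeasure μ] (h : IsLinearSEMSample μ B v X e)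
    {C κ : ℝ} (hC : 0 < C) (hκ : 0 < κ)
    (hX : SubGaussianMarginals μ (semCov B v) C X)
    (hL : IsCholeskyFactor (semCov B v) L) (hs : SingularValuesIn κ L) {u : Fin p → ℝ} {R : ℝ}
    (hR : 0 < R) (hu : u ⬝ᵥ u ≤ R) {δ : ℝ} (hδ : 0 ≤ δ) (hδR : δ ≤ 128 * (2 * C * κ ^ 6 * R)) :
    μ.real {ω | δ ≤ |u ⬝ᵥ (sampleCov (fun k j => X k j ω) - semCov B v) *ᵥ u|} ≤
      2 * Real.exp (-(n * δ ^ 2 / (2048 * (2 * C * κ ^ 6 * R) ^ 2))) := by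
  have hc : 0 < 2 * C * κ ^ 6 * R := by positivity
  have hcc : ((2 * C * κ ^ 6 * R).toNNReal : ℝ) = 2 * C * κ ^ 6 * R := Real.coe_toNNReal _ hc.le
  have hsub : ∀ k, HasSubgaussianMGF (fun ω => u ⬝ᵥ fun j => X k j ω)
      (2 * C * κ ^ 6 * R).toNNReal μ := by
    intro k
    have h1 := h.hasSubgaussianMGF_dotProduct hC.le hκ hX hL hs u k
    refine ⟨h1.integrable_exp_mul, fun t => (h1.mgf_le t).trans ?_⟩
    gcongr
  have hm := h.measurable_obs
  have h2 := measureReal_sum_sq_ge_le (V := u ⬝ᵥ semCov B v *ᵥ u) (h.iIndepFun_dotProduct u) hsub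
    (fun k => by simp only [dotProduct]; fun_prop) (by simpa using hc)
    (h.integral_dotProduct_sq u) hδ (by rwa [hcc])
  rw [hcc] at h2
  simpa only [sub_mulVec, dotProduct_sub, sampleCov_quad] using h2

/-- Outside an event of small probability the sample covariance matrix is close to the covariance
matrix as a quadratic form and along the rows of `L`. -/
theorem measure_deviation_le [IsProbabilityMeasure μ] (h : IsLinearSEMSample μ B v X e)
    {C κ : ℝ} (hC : 0 < C) (hκ : 0 < κ)
    (hX : SubGaussianMarginals μ (semCov B v) C X)
    (hL : IsCholeskyFactor (semCov B v) L) (hs : SingularValuesIn κ L)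
    {η δ : ℝ} (hη : 0 < η) (hηK : η ≤ 128 * (2 * C * κ ^ 6)) (hδ : 0 ≤ δ)
    (hδK : 2 * δ ≤ 128 * (2 * C * κ ^ 6 * (2 * (1 + κ ^ 2)))) :
    μ {ω | (∀ x : Fin p → ℝ, |x ⬝ᵥ (sampleCov (fun k j => X k j ω) - semCov B v) *ᵥ x| ≤
          5 * η * (x ⬝ᵥ x)) ∧
        ∀ i j, |((sampleCov (fun k j => X k j ω) - semCov B v) *ᵥ L i) j| ≤ δ}ᶜ ≤
      ENNReal.ofReal ((4 * p ^ 2 + 1) ^ p *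
          (2 * Real.exp (-(n * η ^ 2 / (2048 * (2 * C * κ ^ 6) ^ 2)))) +
        p ^ 2 * (4 * Real.exp
          (-(n * (2 * δ) ^ 2 / (2048 * (2 * C * κ ^ 6 * (2 * (1 + κ ^ 2))) ^ 2))))) := by
  set q : (Fin p → ℝ) → Ω → ℝ :=
    fun u ω => u ⬝ᵥ (sampleCov (fun k j => X k j ω) - semCov B v) *ᵥ u with hq
  set ε₁ := 2 * Real.exp (-(n * η ^ 2 / (2048 * (2 * C * κ ^ 6) ^ 2))) with hε₁
  set ε₂ := 2 * Real.exp
    (-(n * (2 * δ) ^ 2 / (2048 * (2 * C * κ ^ 6 * (2 * (1 + κ ^ 2))) ^ 2))) with hε₂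
  let G : Finset (Fin p → ℤ) :=
    Fintype.piFinset fun _ => Finset.Icc (-((2 * p ^ 2 : ℕ) : ℤ)) (2 * p ^ 2 : ℕ)
  have hGcard : (G.card : ℝ) = (4 * p ^ 2 + 1) ^ p := by
    simp only [G, Fintype.card_piFinset, Int.card_Icc, Finset.prod_const, Finset.card_univ,
      Fintype.card_fin]
    have : ((2 * p ^ 2 : ℕ) + 1 - -((2 * p ^ 2 : ℕ) : ℤ)).toNat = 4 * p ^ 2 + 1 := by
      omega
    rw [this]
    push_cast
    rfl
  -- The threshold is proportional to `y ⬝ᵥ y`, as is the sub-Gaussian proxy, so all nonzero grid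
  -- points share one exponent; the strict inequality makes the event at `y = 0` empty.
  let E₁ : (Fin p → ℤ) → Set Ω := fun y =>
    {ω | η * ((fun i => (y i : ℝ)) ⬝ᵥ fun i => (y i : ℝ)) < |q (fun i => (y i : ℝ)) ω|}
  -- Score entries are bilinear in `e_j` and `L i`; by polarization, bounds `2 δ` on the forms at
  -- `e_j ± L i` give `(2 δ + 2 δ) / 4 = δ`.
  let E₂ : Fin p × Fin p → Set Ω := fun ij =>
    {ω | 2 * δ ≤ |q (Pi.single ij.2 1 + L ij.1) ω|} ∪
      {ω | 2 * δ ≤ |q (Pi.single ij.2 1 - L ij.1) ω|}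
  have hE₁ : ∀ y, μ.real (E₁ y) ≤ ε₁ := by
    intro y
    rcases (dotProduct_self_nonneg' fun i => (y i : ℝ)).eq_or_lt with h0 | h0
    · have hy : (fun i => (y i : ℝ)) = 0 := dotProduct_self_eq_zero.1 h0.symm
      have : E₁ y = ∅ := by
        ext ω; simp [E₁, hq, hy]
      rw [this, measureReal_empty]
      positivity
    · have h1 := measureReal_quad_deviation_le h hC hκ hX hL hs h0 le_rfl
        (δ := η * ((fun i => (y i : ℝ)) ⬝ᵥ fun i => (y i : ℝ))) (by positivity)
        (by nlinarith [mul_le_mul_of_nonneg_right hηK h0.le])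
      refine (measureReal_mono fun ω hω => ?_).trans (h1.trans_eq ?_)
      · exact (Set.mem_ofPred_eq ▸ hω : _ < _).le
      · rw [hε₁]
        congr 3
        field_simp
  have hnorm : ∀ i j, (Pi.single j 1 + L i) ⬝ᵥ (Pi.single j 1 + L i) ≤ 2 * (1 + κ ^ 2) ∧
      (Pi.single j 1 - L i) ⬝ᵥ (Pi.single j 1 - L i) ≤ 2 * (1 + κ ^ 2) := by
    intro i j
    have h1 := parallelogram (Pi.single j 1) (L i)
    have h2 := hL.row_le hs hκ i
    have h3 := dotProduct_self_nonneg' (Pi.single j 1 + L i)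
    have h4 := dotProduct_self_nonneg' (Pi.single j 1 - L i)
    simp only [single_dotProduct, Pi.single_eq_same, one_mul] at h1
    constructor <;> linarith
  have hE₂ : ∀ ij, μ.real (E₂ ij) ≤ 2 * ε₂ := by
    intro ij
    refine (measureReal_union_le _ _).trans ?_
    have h1 := measureReal_quad_deviation_le h hC hκ hX hL hs (by positivity) (hnorm ij.1 ij.2).1
      (by positivity : 0 ≤ 2 * δ) hδK
    have h2 := measureReal_quad_deviation_le h hC hκ hX hL hs (by positivity) (hnorm ij.1 ij.2).2
      (by positivity : 0 ≤ 2 * δ) hδK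
    rw [two_mul ε₂]
    exact add_le_add h1 h2
  have hsub : {ω | (∀ x : Fin p → ℝ, |q x ω| ≤ 5 * η * (x ⬝ᵥ x)) ∧
      ∀ i j, |((sampleCov (fun k j => X k j ω) - semCov B v) *ᵥ L i) j| ≤ δ}ᶜ ⊆
      (⋃ y ∈ G, E₁ y) ∪ ⋃ ij ∈ (Finset.univ : Finset (Fin p × Fin p)), E₂ ij := by
    intro ω hω
    by_contra hcon
    apply hω
    simp only [Set.mem_union, Set.mem_iUnion, not_or, not_exists, Finset.mem_univ, forall_true_left,
      E₁, E₂, Set.mem_ofPred_eq, not_lt, not_le] at hcon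
    have hA : (sampleCov (fun k j => X k j ω) - semCov B v)ᵀ =
        sampleCov (fun k j => X k j ω) - semCov B v := by
      rw [transpose_sub, sampleCov_transpose, semCov_transpose]
    refine ⟨abs_quad_le_of_grid hA hη.le le_rfl fun y hy => hcon.1 y ?_, fun i j => ?_⟩
    · simp only [G, Fintype.mem_piFinset, Finset.mem_Icc]
      exact fun i => abs_le.1 (hy i)
    · have h1 := hcon.2 (i, j)
      have h2 := abs_bilin_le hA h1.1.le h1.2.le
      rw [single_dotProduct, one_mul] at h2
      linarith
  have hreal : μ.real ((⋃ y ∈ G, E₁ y) ∪ ⋃ ij ∈ (Finset.univ : Finset (Fin p × Fin p)), E₂ ij) ≤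
      (4 * p ^ 2 + 1) ^ p * ε₁ + p ^ 2 * (2 * ε₂) := by
    refine (measureReal_union_le _ _).trans (add_le_add ?_ ?_)
    · refine (measureReal_biUnion_finset_le _ _).trans ?_
      refine (Finset.sum_le_sum fun y _ => hE₁ y).trans_eq ?_
      rw [Finset.sum_const, nsmul_eq_mul, hGcard]
    · refine (measureReal_biUnion_finset_le _ _).trans ?_
      refine (Finset.sum_le_sum fun y _ => hE₂ y).trans_eq ?_
      rw [Finset.sum_const, nsmul_eq_mul, Finset.card_univ, Fintype.card_prod, Fintype.card_fin]
      push_cast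
      ring
  refine (measure_mono hsub).trans ?_
  rw [← ofReal_measureReal (measure_ne_top _ _)]
  refine ENNReal.ofReal_le_ofReal (hreal.trans_eq ?_)
  rw [hε₂]
  ring

end Concentration

end CSCS

/-! ### Deterministic analysis of the estimator, row by row. -/

noncomputable section

namespace CSCS

variable {p : ℕ}

/-- The contribution of row `i` to the objective. -/
def rowObjective (S : Matrix (Fin p) (Fin p) ℝ) (lam : ℝ) (i : Fin p) (b : Fin p → ℝ) : ℝ :=
  b ⬝ᵥ S *ᵥ b - 2 * Real.log (b i) + lam * ∑ j with j < i, |b j|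

theorem objective_eq_sum {S M : Matrix (Fin p) (Fin p) ℝ} {lam : ℝ} (hM : M ∈ lowerPos p) :
    objective S lam M = ∑ i, rowObjective S lam i (M i) := by
  have h1 : (Mᵀ * M * S).trace = ∑ i, M i ⬝ᵥ S *ᵥ M i := by
    rw [Matrix.mul_assoc, trace_mul_comm, Matrix.mul_assoc]
    rfl
  have h2 : Real.log M.det = ∑ i, Real.log (M i i) := by
    rw [det_of_isLowerTriangular M fun i j hij => hM.1 i j hij,
      Real.log_prod fun i _ => (hM.2 i).ne']
  simp only [objective, rowObjective, h1, h2, Finset.sum_add_distrib, Finset.sum_sub_distrib,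
    Finset.mul_sum]

/-- Rows are not coupled by the constraints, so one row of a minimizer may be replaced while the
others stay fixed. -/
theorem IsEstimate.rowObjective_le {S M : Matrix (Fin p) (Fin p) ℝ} {lam : ℝ}
    (hM : IsEstimate S lam M) (i : Fin p) {b : Fin p → ℝ} (hb : ∀ j, i < j → b j = 0)
    (hbi : 0 < b i) : rowObjective S lam i (M i) ≤ rowObjective S lam i b := by
  have hM' : M.updateRow i b ∈ lowerPos p := by
    constructor
    · intro k l hkl
      rcases eq_or_ne k i with rfl | hk
      · rw [updateRow_self]; exact hb l hkl
      · rw [updateRow_ne hk]; exact hM.1.1 k l hkl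
    · intro k
      rcases eq_or_ne k i with rfl | hk
      · rw [updateRow_self]; exact hbi
      · rw [updateRow_ne hk]; exact hM.1.2 k
  have h1 := hM.2 _ hM'
  rw [objective_eq_sum hM.1, objective_eq_sum hM', ← Finset.add_sum_erase _ _ (Finset.mem_univ i),
    ← Finset.add_sum_erase _ (fun k => rowObjective S lam k (M.updateRow i b k))
      (Finset.mem_univ i)] at h1
  have h2 : ∑ k ∈ Finset.univ.erase i, rowObjective S lam k (M.updateRow i b k) =
      ∑ k ∈ Finset.univ.erase i, rowObjective S lam k (M k) :=
    Finset.sum_congr rfl fun k hk => by rw [updateRow_ne (Finset.ne_of_mem_erase hk)]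
  have h3 : M.updateRow i b i = b := updateRow_self
  rw [h2, h3] at h1
  linarith

theorem quad_add (S : Matrix (Fin p) (Fin p) ℝ) (hS : Sᵀ = S) (a d : Fin p → ℝ) :
    (a + d) ⬝ᵥ S *ᵥ (a + d) = a ⬝ᵥ S *ᵥ a + 2 * (d ⬝ᵥ S *ᵥ a) + d ⬝ᵥ S *ᵥ d := by
  have := dotProduct_mulVec_comm hS a d
  simp only [mulVec_add, dotProduct_add, add_dotProduct]
  linarith

/-- The number of nonzero off-diagonal entries of row `i`. -/
def rowSparsity (L : Matrix (Fin p) (Fin p) ℝ) (i : Fin p) : ℕ :=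
  (Finset.univ.filter fun j => i ≠ j ∧ L i j ≠ 0).card

theorem sparsity_eq_sum (L : Matrix (Fin p) (Fin p) ℝ) : sparsity L = ∑ i, rowSparsity L i := by
  have h1 : {ij : Fin p × Fin p | ij.1 ≠ ij.2 ∧ L ij.1 ij.2 ≠ 0} =
      ((Finset.univ.filter fun ij : Fin p × Fin p => ij.1 ≠ ij.2 ∧ L ij.1 ij.2 ≠ 0) :
        Set (Fin p × Fin p)) := by
    ext; simp
  rw [sparsity, h1, Set.ncard_coe_finset]
  simp only [rowSparsity, Finset.card_filter]
  rw [← Finset.univ_product_univ, Finset.sum_product]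

section Row

variable {S L : Matrix (Fin p) (Fin p) ℝ} {lam c δ : ℝ} {i : Fin p} {b : Fin p → ℝ}

/-- The lasso basic inequality. The tangent bound for the concave logarithm turns the linear terms
into the score at `L i`, which the penalty dominates off the support. -/
theorem row_error_le (hS : Sᵀ = S) (hc : 0 < c) (hquad : ∀ x, c * (x ⬝ᵥ x) ≤ x ⬝ᵥ S *ᵥ x)
    (hL : L ∈ lowerPos p)
    (hgrad : ∀ j, j ≤ i → |(S *ᵥ L i) j - if j = i then (L i i)⁻¹ else 0| ≤ δ)
    (hδ : 4 * δ ≤ lam) (hlam : 0 ≤ lam) (hb : ∀ j, i < j → b j = 0) (hbi : 0 < b i)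
    (hmin : rowObjective S lam i b ≤ rowObjective S lam i (L i)) :
    c ^ 2 * ((b - L i) ⬝ᵥ (b - L i)) ≤ 9 / 4 * lam ^ 2 * (rowSparsity L i + 1) := by
  have hℓi := hL.2 i
  set d := b - L i with hd
  have hbd : b = L i + d := by rw [hd]; abel
  have hd0 : ∀ j, i < j → d j = 0 := fun j hj => by
    rw [hd, Pi.sub_apply, hb j hj, hL.1 i j hj, sub_zero]
  set N := d ⬝ᵥ d with hN
  have hN0 : 0 ≤ N := dotProduct_self_nonneg' d
  have hlog : Real.log (b i) - Real.log (L i i) ≤ d i * (L i i)⁻¹ := by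
    rw [← Real.log_div hbi.ne' hℓi.ne']
    refine (Real.log_le_sub_one_of_pos (by positivity)).trans_eq ?_
    rw [hd, Pi.sub_apply]
    field_simp
  have hcross : d ⬝ᵥ S *ᵥ L i - d i * (L i i)⁻¹ =
      ∑ j, d j * ((S *ᵥ L i) j - if j = i then (L i i)⁻¹ else 0) := by
    simp only [mul_sub, Finset.sum_sub_distrib, mul_ite, mul_zero, Finset.sum_ite_eq',
      Finset.mem_univ, if_true]
    rfl
  have hcross' : -∑ j, δ * |d j| ≤
      ∑ j, d j * ((S *ᵥ L i) j - if j = i then (L i i)⁻¹ else 0) := by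
    rw [← Finset.sum_neg_distrib]
    refine Finset.sum_le_sum fun j _ => ?_
    rcases lt_or_ge i j with hj | hj
    · simp [hd0 j hj]
    · have h1 := mul_le_mul_of_nonneg_left (hgrad j hj) (abs_nonneg (d j))
      rw [← abs_mul] at h1
      linarith [neg_abs_le (d j * ((S *ᵥ L i) j - if j = i then (L i i)⁻¹ else 0))]
  -- The diagonal position is unpenalized and must be counted with the support; this is the origin
  -- of the `+ 1`.
  set T := insert i (Finset.univ.filter fun j => i ≠ j ∧ L i j ≠ 0) with hT
  -- The noise costs at most `lam / 2 * |d j|` per entry. On the support the penalty adds at most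
  -- `lam * |d j|`; at zero entries below the diagonal it gains that amount, leaving a nonpositive
  -- term.
  have hpen : ∑ j, 2 * (δ * |d j|) + lam * (∑ j with j < i, |L i j| - ∑ j with j < i, |b j|) ≤
      3 / 2 * lam * ∑ j ∈ T, |d j| := by
    have hTsum : 3 / 2 * lam * ∑ j ∈ T, |d j| = ∑ j, if j ∈ T then 3 / 2 * lam * |d j| else 0 := by
      rw [Finset.mul_sum, Finset.sum_ite_mem, Finset.univ_inter]
    rw [hTsum, ← Finset.sum_sub_distrib, Finset.sum_filter, Finset.mul_sum,
      ← Finset.sum_add_distrib]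
    refine Finset.sum_le_sum fun j _ => ?_
    have habs : |L i j| - |b j| ≤ |d j| := by
      rw [hd, Pi.sub_apply, abs_sub_comm]
      exact abs_sub_abs_le_abs_sub _ _
    have hdj := abs_nonneg (d j)
    have h4 : 4 * δ * |d j| ≤ lam * |d j| := by gcongr
    have h5 : lam * (|L i j| - |b j|) ≤ lam * |d j| := by gcongr
    rcases lt_trichotomy j i with hj | hj | hj
    · rw [if_pos hj]
      by_cases h0 : L i j = 0
      · have : j ∉ T := by simp [hT, hj.ne, h0]
        rw [if_neg this]
        have h6 : b j = d j := by rw [hd, Pi.sub_apply, h0, sub_zero]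
        rw [h0, h6, abs_zero]
        nlinarith [mul_nonneg hlam hdj]
      · have : j ∈ T := by simp [hT, hj.ne', h0]
        rw [if_pos this]
        nlinarith
    · have : j ∈ T := by simp [hT, hj]
      rw [if_pos this, if_neg (by simp [hj])]
      nlinarith [mul_nonneg hlam hdj]
    · have : j ∉ T := by simp [hT, hj.ne', hL.1 i j hj]
      rw [if_neg this, if_neg hj.not_gt, hd0 j hj]
      simp
  have hmain : c * N ≤ 3 / 2 * lam * ∑ j ∈ T, |d j| := by
    refine le_trans ?_ hpen
    have h1 := hquad d
    rw [rowObjective, rowObjective, hbd, quad_add S hS, ← hbd] at hmin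
    rw [← Finset.mul_sum]
    linarith
  have hcs : (∑ j ∈ T, |d j|) ^ 2 ≤ (rowSparsity L i + 1) * N := by
    refine sq_sum_le_card_mul_sum_sq.trans ?_
    have hcard : (T.card : ℝ) = rowSparsity L i + 1 := by
      rw [hT, Finset.card_insert_of_notMem (by simp), rowSparsity]
      push_cast
      rfl
    rw [hcard]
    refine mul_le_mul_of_nonneg_left ?_ (by positivity)
    rw [hN, dotProduct]
    refine (Finset.sum_le_univ_sum_of_nonneg fun j => sq_nonneg |d j|).trans_eq ?_
    exact Finset.sum_congr rfl fun j _ => by rw [sq_abs, sq]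
  rcases hN0.eq_or_lt with h0 | h0
  · rw [← h0, mul_zero]; positivity
  · refine le_of_mul_le_mul_right ?_ h0
    calc c ^ 2 * N * N = (c * N) ^ 2 := by ring
      _ ≤ (3 / 2 * lam * ∑ j ∈ T, |d j|) ^ 2 := pow_le_pow_left₀ (by positivity) hmain 2
      _ = 9 / 4 * lam ^ 2 * (∑ j ∈ T, |d j|) ^ 2 := by ring
      _ ≤ 9 / 4 * lam ^ 2 * ((rowSparsity L i + 1) * N) := by gcongr
      _ = _ := by ring

/-- Rows of `L` without off-diagonal entries are recovered exactly off the diagonal. -/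
theorem row_eq_zero (hS : Sᵀ = S) (hc : 0 < c) (hquad : ∀ x, c * (x ⬝ᵥ x) ≤ x ⬝ᵥ S *ᵥ x)
    (hL : L ∈ lowerPos p)
    (hgrad : ∀ j, j ≤ i → |(S *ᵥ L i) j - if j = i then (L i i)⁻¹ else 0| ≤ δ)
    (hδ : 4 * δ ≤ lam) (hb : ∀ j, i < j → b j = 0) (hbi : 0 < b i) (hbL : b i ≤ 2 * L i i)
    (hdiag : ∀ j, j ≠ i → L i j = 0)
    (hmin : rowObjective S lam i b ≤ rowObjective S lam i (Pi.single i (b i))) {j : Fin p}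
    (hj : j ≠ i) : b j = 0 := by
  have hℓi := hL.2 i
  have hδ0 : 0 ≤ δ := (abs_nonneg _).trans (hgrad i le_rfl)
  -- The competitor keeps the diagonal of `b`, so the logarithms cancel. As `L i` is diagonal too,
  -- `a` is a multiple of it with factor at most 2, and its score is at most `2 δ`. The cross term
  -- thus costs at most `4 δ ≤ lam` per unit of penalty, so only `d = 0` remains.
  set a : Fin p → ℝ := Pi.single i (b i) with ha
  set d := b - a with hd
  have hbd : b = a + d := by rw [hd]; abel
  have hai : a i = b i := by simp [ha]
  have hdi : d i = 0 := by rw [hd, Pi.sub_apply, hai, sub_self]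
  have hdj : ∀ j, j ≠ i → d j = b j := fun j hj => by simp [hd, ha, hj]
  have haL : a = (b i / L i i) • L i := by
    funext k
    rcases eq_or_ne k i with rfl | hk
    · rw [hai, Pi.smul_apply, smul_eq_mul]; field_simp
    · rw [Pi.smul_apply, hdiag k hk, smul_zero, ha, Pi.single_eq_of_ne hk]
  have hpen0 : ∑ j with j < i, |a j| = 0 :=
    Finset.sum_eq_zero fun k hk => by
      rw [ha, Pi.single_eq_of_ne (Finset.mem_filter.1 hk).2.ne, abs_zero]
  have hcross : -(δ * ∑ k with k < i, |b k|) ≤ d ⬝ᵥ S *ᵥ L i := by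
    rw [dotProduct, Finset.mul_sum, ← Finset.sum_neg_distrib, Finset.sum_filter]
    refine Finset.sum_le_sum fun k _ => ?_
    rcases lt_trichotomy k i with hk | hk | hk
    · rw [if_pos hk, hdj k hk.ne]
      have h1 := hgrad k hk.le
      rw [if_neg hk.ne, sub_zero] at h1
      have h2 := mul_le_mul_of_nonneg_left h1 (abs_nonneg (b k))
      rw [← abs_mul] at h2
      linarith [neg_abs_le (b k * (S *ᵥ L i) k)]
    · rw [if_neg (by simp [hk]), hk, hdi, zero_mul]
    · rw [if_neg hk.not_gt, hdj k hk.ne', hb k hk, zero_mul]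
  set P := ∑ k with k < i, |b k| with hP
  have hP0 : 0 ≤ P := Finset.sum_nonneg fun _ _ => abs_nonneg _
  have hq := hquad d
  have hN0 := dotProduct_self_nonneg' d
  have hcross2 : -(2 * δ * P) ≤ d ⬝ᵥ S *ᵥ a := by
    rw [haL, mulVec_smul, dotProduct_smul, smul_eq_mul]
    have h1 : b i / L i i ≤ 2 := by rwa [div_le_iff₀ hℓi]
    have h2 : 0 < b i / L i i := by positivity
    have h3 := mul_le_mul_of_nonneg_left hcross h2.le
    have h4 : b i / L i i * (δ * P) ≤ 2 * (δ * P) := by gcongr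
    linarith
  rw [rowObjective, rowObjective, hpen0, hai, hbd, quad_add S hS, ← hbd, ← hP] at hmin
  have h1 : 4 * δ * P ≤ lam * P := by gcongr
  have h2 : c * (d ⬝ᵥ d) ≤ 0 := by linarith
  have h3 : d ⬝ᵥ d = 0 := le_antisymm (by
    by_contra hcon
    exact absurd (mul_pos hc (not_le.1 hcon)) h2.not_gt) hN0
  have h4 : d = 0 := dotProduct_self_eq_zero.1 h3
  rw [← hdj j hj, h4, Pi.zero_apply]

end Row

/-- Rows with off-diagonal entries absorb the diagonal count into `rowSparsity`. In the others the
crude bound of `row_error_le` gives `M i i ≤ 2 * L i i`, which is what `row_eq_zero` needs to remove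
their contribution. -/
theorem offDiagNorm_le {S L M : Matrix (Fin p) (Fin p) ℝ} {lam c δ : ℝ}
    (hS : Sᵀ = S) (hc : 0 < c) (hquad : ∀ x, c * (x ⬝ᵥ x) ≤ x ⬝ᵥ S *ᵥ x)
    (hL : L ∈ lowerPos p)
    (hgrad : ∀ i j, j ≤ i → |(S *ᵥ L i) j - if j = i then (L i i)⁻¹ else 0| ≤ δ)
    (hδ : 4 * δ ≤ lam) (hlam : 0 ≤ lam) (hdiag : ∀ i, 3 / 2 * lam ≤ c * L i i)
    (hM : IsEstimate S lam M) :
    offDiagNorm (M - L) ≤ 3 * lam / c * √(sparsity L) := by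
  have hrow : ∀ i, ∑ j with j ≠ i, (M - L) i j ^ 2 ≤ 9 * lam ^ 2 / c ^ 2 * rowSparsity L i := by
    intro i
    have hub := row_error_le hS hc hquad hL (hgrad i) hδ hlam (hM.1.1 i) (hM.1.2 i)
      (hM.rowObjective_le i (hL.1 i) (hL.2 i))
    rcases Nat.eq_zero_or_pos (rowSparsity L i) with h0 | h0
    · have hz : ∀ j, j ≠ i → L i j = 0 := by
        intro j hj
        rw [rowSparsity, Finset.card_eq_zero, Finset.filter_eq_empty_iff] at h0
        have := h0 (Finset.mem_univ j)
        by_contra hcon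
        exact this ⟨hj.symm, hcon⟩
      have hMi : M i i ≤ 2 * L i i := by
        rw [h0] at hub
        have h1 := sq_apply_le_dotProduct_self (M i - L i) i
        have h2 : (c * (M i i - L i i)) ^ 2 ≤ (c * L i i) ^ 2 := by
          calc (c * (M i i - L i i)) ^ 2 = c ^ 2 * (M i - L i) i ^ 2 := by
                rw [Pi.sub_apply]; ring
            _ ≤ c ^ 2 * ((M i - L i) ⬝ᵥ (M i - L i)) := by gcongr
            _ ≤ 9 / 4 * lam ^ 2 * ((0 : ℕ) + 1) := hub
            _ = (3 / 2 * lam) ^ 2 := by push_cast; ring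
            _ ≤ (c * L i i) ^ 2 := pow_le_pow_left₀ (by positivity) (hdiag i) 2
        have h3 := (abs_le.1 (abs_le_of_sq_le_sq h2 (mul_pos hc (hL.2 i)).le)).2
        have h4 := le_of_mul_le_mul_left h3 hc
        linarith
      have hzero : ∀ j, j ≠ i → M i j = 0 := fun j hj =>
        row_eq_zero hS hc hquad hL (hgrad i) hδ (hM.1.1 i) (hM.1.2 i) hMi hz
          (hM.rowObjective_le i (fun k hk => by rw [Pi.single_eq_of_ne hk.ne'])
            (by rw [Pi.single_eq_same]; exact hM.1.2 i)) hj
      rw [h0, Finset.sum_eq_zero]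
      · simp
      · intro j hj
        have hj' := (Finset.mem_filter.1 hj).2
        rw [Matrix.sub_apply, hzero j hj', hz j hj', sub_zero, zero_pow two_ne_zero]
    · have h1 : (1 : ℝ) ≤ rowSparsity L i := by exact_mod_cast h0
      have h2 : ∑ j with j ≠ i, (M - L) i j ^ 2 ≤ (M i - L i) ⬝ᵥ (M i - L i) := by
        rw [dotProduct]
        refine (Finset.sum_le_univ_sum_of_nonneg fun j => sq_nonneg _).trans_eq ?_
        exact Finset.sum_congr rfl fun j _ => by rw [sq]; rfl
      refine h2.trans ?_
      rw [div_mul_eq_mul_div, le_div_iff₀ (by positivity)]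
      nlinarith [sq_nonneg lam, mul_le_mul_of_nonneg_left h1 (sq_nonneg lam)]
  have hsum : ∑ i, ∑ j with j ≠ i, (M - L) i j ^ 2 ≤ 9 * lam ^ 2 / c ^ 2 * sparsity L := by
    refine (Finset.sum_le_sum fun i _ => hrow i).trans_eq ?_
    rw [← Finset.mul_sum, sparsity_eq_sum]
    push_cast
    rfl
  rw [offDiagNorm]
  refine Real.sqrt_le_iff.2 ⟨by positivity, hsum.trans_eq ?_⟩
  rw [mul_pow, Real.sq_sqrt (Nat.cast_nonneg _)]
  ring

/-- Coercivity: half of the quadratic form absorbs the logarithm, and the logarithm keeps the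
diagonal entry away from zero. The sublevel set of `b₀` thus lies in a compact set on which the
objective is continuous. -/
theorem exists_rowObjective_min {S : Matrix (Fin p) (Fin p) ℝ} {lam c : ℝ}
    (hc : 0 < c) (hquad : ∀ x, c * (x ⬝ᵥ x) ≤ x ⬝ᵥ S *ᵥ x) (hlam : 0 ≤ lam) (i : Fin p) :
    ∃ b : Fin p → ℝ, (∀ j, i < j → b j = 0) ∧ 0 < b i ∧
      ∀ a : Fin p → ℝ, (∀ j, i < j → a j = 0) → 0 < a i →
        rowObjective S lam i b ≤ rowObjective S lam i a := by
  set f := rowObjective S lam i with hf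
  set b₀ : Fin p → ℝ := Pi.single i 1 with hb₀
  set k := Real.log (2 / c) - 1 with hk
  have hb₀z : ∀ j, i < j → b₀ j = 0 := fun j hj => by rw [hb₀, Pi.single_eq_of_ne hj.ne']
  have hb₀i : 0 < b₀ i := by simp [hb₀]
  let K : Set (Fin p → ℝ) := {b | (∀ j, i < j → b j = 0) ∧ Real.exp (-(f b₀ / 2)) ≤ b i ∧
    b ⬝ᵥ b ≤ 2 * (f b₀ + k) / c}
  have hpen : ∀ b : Fin p → ℝ, 0 ≤ lam * ∑ j with j < i, |b j| := fun b =>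
    mul_nonneg hlam (Finset.sum_nonneg fun _ _ => abs_nonneg _)
  have hsub : ∀ b : Fin p → ℝ, (∀ j, i < j → b j = 0) → 0 < b i → f b ≤ f b₀ → b ∈ K := by
    intro b hbz hbi hle
    have hq := hquad b
    have hP := hpen b
    have hN := dotProduct_self_nonneg' b
    have hfb : f b = b ⬝ᵥ S *ᵥ b - 2 * Real.log (b i) + lam * ∑ j with j < i, |b j| := rfl
    refine ⟨hbz, ?_, ?_⟩
    · rw [← Real.le_log_iff_exp_le hbi]
      have : 0 ≤ c * (b ⬝ᵥ b) := by positivity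
      linarith
    · have h1 : 2 * Real.log (b i) ≤ c / 2 * b i ^ 2 + k := by
        have h2 := Real.log_le_sub_one_of_pos (by positivity : 0 < c / 2 * b i ^ 2)
        rw [Real.log_mul (by positivity) (by positivity), Real.log_pow] at h2
        have h3 : Real.log (2 / c) = -Real.log (c / 2) := by
          rw [← Real.log_inv, inv_div]
        push_cast at h2
        rw [hk, h3]
        linarith
      have h4 : c / 2 * b i ^ 2 ≤ c / 2 * (b ⬝ᵥ b) := by
        gcongr
        exact sq_apply_le_dotProduct_self b i
      rw [le_div_iff₀ hc]
      linarith
  have hKc : IsCompact K := by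
    have hclosed : IsClosed K := by
      have h1 : IsClosed {b : Fin p → ℝ | ∀ j, i < j → b j = 0} := by
        simp only [Set.ofPred_forall]
        exact isClosed_iInter fun j => isClosed_iInter fun _ =>
          isClosed_eq (continuous_apply j) continuous_const
      have h2 : IsClosed {b : Fin p → ℝ | Real.exp (-(f b₀ / 2)) ≤ b i} :=
        isClosed_le continuous_const (continuous_apply i)
      have h3 : IsClosed {b : Fin p → ℝ | b ⬝ᵥ b ≤ 2 * (f b₀ + k) / c} :=
        isClosed_le (by simp only [dotProduct]; fun_prop) continuous_const
      exact h1.inter (h2.inter h3)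
    refine (isCompact_univ_pi fun _ : Fin p => isCompact_Icc
      (a := -√(2 * (f b₀ + k) / c)) (b := √(2 * (f b₀ + k) / c))).of_isClosed_subset hclosed ?_
    intro b hb j _
    exact abs_le.1 (Real.abs_le_sqrt ((sq_apply_le_dotProduct_self b j).trans hb.2.2))
  have hcont : ContinuousOn f K := by
    have h1 : ContinuousOn (fun b : Fin p → ℝ => Real.log (b i)) K :=
      ContinuousOn.log (continuous_apply i).continuousOn fun b hb =>
        ((Real.exp_pos _).trans_le hb.2.1).ne'
    have h2 : Continuous fun b : Fin p → ℝ => b ⬝ᵥ S *ᵥ b := by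
      simp only [dotProduct, mulVec]; fun_prop
    have h3 : Continuous fun b : Fin p → ℝ => lam * ∑ j with j < i, |b j| := by fun_prop
    exact (h2.continuousOn.sub (continuousOn_const.mul h1)).add h3.continuousOn
  obtain ⟨b, hbK, hbmin⟩ := hKc.exists_isMinOn ⟨b₀, hsub b₀ hb₀z hb₀i le_rfl⟩ hcont
  refine ⟨b, hbK.1, (Real.exp_pos _).trans_le hbK.2.1, fun a haz hai => ?_⟩
  rcases le_total (f a) (f b₀) with h | h
  · exact hbmin (hsub a haz hai h)
  · exact (hbmin (hsub b₀ hb₀z hb₀i le_rfl)).trans h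

theorem exists_isEstimate {S : Matrix (Fin p) (Fin p) ℝ} {lam c : ℝ}
    (hc : 0 < c) (hquad : ∀ x, c * (x ⬝ᵥ x) ≤ x ⬝ᵥ S *ᵥ x) (hlam : 0 ≤ lam) :
    ∃ M, IsEstimate S lam M := by
  choose b hb hbi hmin using exists_rowObjective_min (S := S) hc hquad hlam
  have hM : Matrix.of b ∈ lowerPos p := ⟨fun i j hij => hb i j hij, fun i => hbi i⟩
  refine ⟨Matrix.of b, hM, fun L hL => ?_⟩
  rw [objective_eq_sum hM, objective_eq_sum hL]
  exact Finset.sum_le_sum fun i _ => hmin i (L i) (hL.1 i) (hL.2 i)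

theorem abs_apply_le_offDiagNorm (A : Matrix (Fin p) (Fin p) ℝ) {i j : Fin p} (hij : i ≠ j) :
    |A i j| ≤ offDiagNorm A := by
  refine Real.abs_le_sqrt ?_
  have h1 := Finset.single_le_sum (f := fun j => A i j ^ 2) (fun _ _ => sq_nonneg _)
    (Finset.mem_filter.2 ⟨Finset.mem_univ j, hij.symm⟩ :
      j ∈ Finset.univ.filter fun j => j ≠ i)
  have h2 := Finset.single_le_sum (f := fun i => ∑ j with j ≠ i, A i j ^ 2)
    (fun _ _ => Finset.sum_nonneg fun _ _ => sq_nonneg _) (Finset.mem_univ i)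
  exact h1.trans h2

/-- Each entry errs by at most `τ`: a zero entry does not pass the strict threshold, and one larger
than `2 τ` in absolute value stays beyond `τ` on its own side. -/
theorem sign_threshold_eq {L M : Matrix (Fin p) (Fin p) ℝ} {τ ℓ : ℝ}
    (hℓ : 2 * τ ≤ ℓ) (hmin : MinStrength ℓ L) (herr : offDiagNorm (M - L) ≤ τ) {i j : Fin p}
    (hij : i ≠ j) : SignType.sign (threshold τ M i j) = SignType.sign (L i j) := by
  have h1 : |M i j - L i j| ≤ τ := (abs_apply_le_offDiagNorm (M - L) hij).trans herr
  rw [abs_le] at h1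
  rw [threshold, of_apply]
  rcases lt_trichotomy (L i j) 0 with h | h | h
  · have h2 := hmin i j hij h.ne
    rw [abs_of_neg h] at h2
    have h3 : M i j < -τ := by linarith
    rw [if_pos (lt_abs.2 (Or.inr (by linarith))), sign_neg (by linarith), sign_neg h]
  · rw [h, sub_zero] at h1
    rw [if_neg (abs_le.2 h1).not_gt, h]
  · have h2 := hmin i j hij h.ne'
    rw [abs_of_pos h] at h2
    rw [if_pos (lt_abs.2 (Or.inl (by linarith))), sign_pos (by linarith), sign_pos h]

end CSCS

end

/-! ### Asymptotics and the main theorem. -/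

namespace CSCS

theorem rate_eq_mul (m p n : ℕ) : rate m p n = rate 1 p n * √m := by
  rw [rate, rate, Nat.cast_one, one_mul, mul_div_assoc, Real.sqrt_mul (Nat.cast_nonneg _), mul_comm]

theorem rate_nonneg (m p n : ℕ) : 0 ≤ rate m p n := Real.sqrt_nonneg _

/-- On the event that the sample covariance matrix is close to the covariance matrix, an estimate
exists and every estimate is close to `L`. -/
theorem exists_isEstimate_and_offDiagNorm_le {p : ℕ} {S Sigma L : Matrix (Fin p) (Fin p) ℝ}
    {κ η δ lam : ℝ} (hκ : 0 < κ) (hS : Sᵀ = S) (hL : IsCholeskyFactor Sigma L)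
    (hs : SingularValuesIn κ L) (hη : 10 * η ≤ (κ ^ 2)⁻¹)
    (hquad : ∀ x : Fin p → ℝ, |x ⬝ᵥ (S - Sigma) *ᵥ x| ≤ 5 * η * (x ⬝ᵥ x))
    (hrow : ∀ i j, |((S - Sigma) *ᵥ L i) j| ≤ δ) (hδ : 4 * δ ≤ lam) (hlam : 0 ≤ lam)
    (hlam' : 3 * lam * κ ^ 3 ≤ 1) :
    (∃ M, IsEstimate S lam M) ∧
      ∀ M, IsEstimate S lam M → offDiagNorm (M - L) ≤ 6 * κ ^ 2 * lam * √(sparsity L) := by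
  -- `Sigma` is bounded below by `κ⁻²`, and the deviation `5 η` uses up at most half of this.
  have hc : 0 < (κ ^ 2)⁻¹ / 2 := by positivity
  have hq : ∀ x : Fin p → ℝ, (κ ^ 2)⁻¹ / 2 * (x ⬝ᵥ x) ≤ x ⬝ᵥ S *ᵥ x := by
    intro x
    have h1 := (abs_le.1 (hquad x)).1
    rw [sub_mulVec, dotProduct_sub] at h1
    have h2 := hL.le_quad hs hκ x
    rw [← inv_mul_le_iff₀ (by positivity)] at h2
    have h3 := mul_le_mul_of_nonneg_right hη (dotProduct_self_nonneg' x)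
    linarith
  refine ⟨exists_isEstimate hc hq hlam, fun M hM => ?_⟩
  refine (offDiagNorm_le (δ := δ) hS hc hq hL.1 (fun i j hj => ?_) hδ hlam (fun i => ?_)
    hM).trans_eq ?_
  · have h1 := hrow i j
    rwa [sub_mulVec, Pi.sub_apply, hL.mulVec_row hj] at h1
  · have h1 := hL.inv_le_diag hs hκ i
    have h2 : (κ ^ 2)⁻¹ / 2 * κ⁻¹ ≤ (κ ^ 2)⁻¹ / 2 * L i i := by gcongr
    refine le_trans ?_ h2
    have h3 : (κ ^ 2)⁻¹ / 2 * κ⁻¹ = 1 / (2 * κ ^ 3) := by field_simp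
    rw [h3, le_div_iff₀ (by positivity)]
    linarith
  · field_simp
    ring

theorem tendsto_rate {p s : ℕ → ℕ} (hp : Tendsto p atTop atTop)
    (h : Tendsto (fun n => ((s n : ℝ) + p n) * Real.log (p n) / n) atTop (𝓝 0)) :
    Tendsto (fun n => rate 1 (p n) n) atTop (𝓝 0) := by
  have h1 : Tendsto (fun n => Real.log (p n) / n) atTop (𝓝 0) := by
    refine squeeze_zero' (Eventually.of_forall fun n => ?_) ?_ h
    · exact div_nonneg (Real.log_natCast_nonneg _) (Nat.cast_nonneg _)
    · filter_upwards [hp.eventually_ge_atTop 1] with n hn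
      have h2 : (1 : ℝ) ≤ p n := by exact_mod_cast hn
      have h3 : (0 : ℝ) ≤ s n := Nat.cast_nonneg _
      refine div_le_div_of_nonneg_right ?_ (Nat.cast_nonneg _)
      exact le_mul_of_one_le_left (Real.log_natCast_nonneg _) (by linarith)
  have h2 := (Real.continuous_sqrt.tendsto 0).comp h1
  rw [Real.sqrt_zero] at h2
  refine h2.congr fun n => ?_
  simp [rate]

/-- The cardinality of the grid is at most `p ^ (5 p)`, which consumes at most half of the exponent.
-/
theorem grid_term_le {p : ℕ} (hp : 2 ≤ p) {a x : ℝ} (h : 5 * (p * Real.log p) ≤ a / 2 * x) :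
    (4 * (p : ℝ) ^ 2 + 1) ^ p * (2 * Real.exp (-(a * x))) ≤ 2 * Real.exp (-(a / 2 * x)) := by
  have hp2 : (2 : ℝ) ≤ p := by exact_mod_cast hp
  have h1 : 4 * (p : ℝ) ^ 2 + 1 ≤ p ^ 5 := by
    have h2 : (8 : ℝ) ≤ p ^ 3 := by
      calc (8 : ℝ) = 2 ^ 3 := by norm_num
        _ ≤ p ^ 3 := by gcongr
    nlinarith [mul_le_mul_of_nonneg_right h2 (sq_nonneg (p : ℝ))]
  have h2 : (4 * (p : ℝ) ^ 2 + 1) ^ p ≤ Real.exp (a / 2 * x) := by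
    calc (4 * (p : ℝ) ^ 2 + 1) ^ p ≤ ((p : ℝ) ^ 5) ^ p := by gcongr
      _ = Real.exp (5 * (p * Real.log p)) := by
          rw [← Real.exp_log (by positivity : 0 < ((p : ℝ) ^ 5) ^ p), Real.log_pow, Real.log_pow]
          push_cast
          ring_nf
      _ ≤ _ := Real.exp_le_exp.2 h
  calc _ ≤ Real.exp (a / 2 * x) * (2 * Real.exp (-(a * x))) := by gcongr
    _ = 2 * (Real.exp (a / 2 * x) * Real.exp (-(a * x))) := by ring
    _ = _ := by
        rw [← Real.exp_add]
        ring_nf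

theorem pair_term_le {p : ℕ} (hp : 2 ≤ p) {x : ℝ} (h : 3 * Real.log p ≤ x) :
    (p : ℝ) ^ 2 * (4 * Real.exp (-x)) ≤ 4 / p := by
  have hp0 : (0 : ℝ) < p := by positivity
  have h1 : Real.exp (-x) ≤ ((p : ℝ) ^ 3)⁻¹ := by
    rw [Real.exp_neg]
    refine inv_anti₀ (by positivity) ?_
    rw [← Real.log_le_iff_le_exp (by positivity), Real.log_pow]
    exact_mod_cast h
  calc (p : ℝ) ^ 2 * (4 * Real.exp (-x)) ≤ (p : ℝ) ^ 2 * (4 * ((p : ℝ) ^ 3)⁻¹) := by gcongr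
    _ = 4 / (p : ℝ) := by field_simp

end CSCS

theorem mainTheorem3 (C κ : ℝ) (hC : 0 < C) (hκ : 0 < κ) :
    ∃ a₀ : ℝ, 0 < a₀ ∧ ∀ A : ℝ, a₀ ≤ A → ∃ c₀ : ℝ, 0 < c₀ ∧
      ∀ c₁ c₂ : ℝ, c₀ ≤ c₂ → 2 * c₂ < c₁ →
      ∀ (p : ℕ → ℕ)
        (B L : ∀ n, Matrix (Fin (p n)) (Fin (p n)) ℝ)
        (v : ∀ n, Fin (p n) → ℝ)
        (lam : ℕ → ℝ)
        (Ω : ℕ → Type*) (_ : ∀ n, MeasurableSpace (Ω n)) (μ : ∀ n, Measure (Ω n))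
        (_ : ∀ n, IsProbabilityMeasure (μ n))
        (X e : ∀ n, Fin n → Fin (p n) → Ω n → ℝ),
        -- the high-dimensional scaling, with `n` the sample size
        Tendsto p atTop atTop →
        Tendsto (fun n => ((CSCS.sparsity (L n) : ℝ) + p n) * Real.log (p n) / n) atTop (𝓝 0) →
        -- the model, its Cholesky factor, and the assumptions
        (∀ n, CSCS.IsLinearSEMSample (μ n) (B n) (v n) (X n) (e n)) →
        (∀ n, CSCS.IsCholeskyFactor (CSCS.semCov (B n) (v n)) (L n)) →
        (∀ n, CSCS.SubGaussianMarginals (μ n) (CSCS.semCov (B n) (v n)) C (X n)) →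
        (∀ n, CSCS.SingularValuesIn κ (L n)) →
        (∀ n, CSCS.MinStrength (c₁ * CSCS.rate (CSCS.sparsity (L n)) (p n) n) (L n)) →
        -- the tuning parameter is of scale `√(log p / n)`
        (∀ n, a₀ * CSCS.rate 1 (p n) n ≤ lam n ∧ lam n ≤ A * CSCS.rate 1 (p n) n) →
        -- a CSCS estimate exists
        CSCS.WithProbTendingToOne μ (fun n => {ω | ∃ M,
          CSCS.IsEstimate (CSCS.sampleCov fun k j => X n k j ω) (lam n) M}) ∧
        -- `c₂` bounds the off-diagonal estimation error
        CSCS.WithProbTendingToOne μ (fun n => {ω | ∀ M,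
          CSCS.IsEstimate (CSCS.sampleCov fun k j => X n k j ω) (lam n) M →
            CSCS.offDiagNorm (M - L n) ≤ c₂ * CSCS.rate (CSCS.sparsity (L n)) (p n) n}) ∧
        -- the thresholded estimate recovers all off-diagonal signs
        CSCS.WithProbTendingToOne μ (fun n => {ω | ∀ M,
          CSCS.IsEstimate (CSCS.sampleCov fun k j => X n k j ω) (lam n) M →
            ∀ i j, i ≠ j →
              SignType.sign (CSCS.threshold
                (c₂ * CSCS.rate (CSCS.sparsity (L n)) (p n) n) M i j) =
              SignType.sign (L n i j)}) := by
  have hK : 0 < 2 * C * κ ^ 6 := by positivity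
  obtain ⟨K, hKdef⟩ : ∃ K, K = 2 * C * κ ^ 6 := ⟨_, rfl⟩
  obtain ⟨R, hRdef⟩ : ∃ R, R = 2 * (1 + κ ^ 2) := ⟨_, rfl⟩
  rw [← hKdef] at hK
  have hR : 0 < R := by rw [hRdef]; positivity
  -- `K` is the sub-Gaussian proxy per unit of `u ⬝ᵥ u`, and `R` bounds the squared length of `e_j ±
  -- L i`. With `δ = 40 K R √(log p / n)` the score exponent is `25 / 8 * log p`, just above the `3
  -- log p` needed for `p²` pairs; `4 δ ≤ lam` then dictates 160.
  refine ⟨160 * (K * R), by positivity, fun A hA => ⟨6 * κ ^ 2 * A, ?_, ?_⟩⟩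
  · have : 0 < A := lt_of_lt_of_le (by positivity) hA
    positivity
  intro c₁ c₂ hc₂ hc₁ p B L v lam Ω mΩ μ hμ X e hp hscale hmodel hchol hsub hsing hmin hlam
  have hA0 : 0 < A := lt_of_lt_of_le (by positivity) hA
  obtain ⟨η, hη, hη1, hη2⟩ : ∃ η : ℝ, 0 < η ∧ 10 * η ≤ (κ ^ 2)⁻¹ ∧ η ≤ 128 * K := by
    refine ⟨min ((κ ^ 2)⁻¹ / 10) (128 * K), by positivity, ?_, min_le_right _ _⟩
    linarith [min_le_left ((κ ^ 2)⁻¹ / 10) (128 * K)]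
  have hrate := CSCS.tendsto_rate hp hscale
  let δ : ℕ → ℝ := fun n => 40 * (K * R) * CSCS.rate 1 (p n) n
  let G : ∀ n, Set (Ω n) := fun n =>
    {ω | (∀ x : Fin (p n) → ℝ,
        |x ⬝ᵥ (CSCS.sampleCov (fun k j => X n k j ω) - CSCS.semCov (B n) (v n)) *ᵥ x| ≤
          5 * η * (x ⬝ᵥ x)) ∧
      ∀ i j, |((CSCS.sampleCov (fun k j => X n k j ω) - CSCS.semCov (B n) (v n)) *ᵥ L n i) j| ≤ δ n}
  obtain ⟨a, ha⟩ : ∃ a, a = η ^ 2 / (2048 * K ^ 2) := ⟨_, rfl⟩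
  have ha0 : 0 < a := by rw [ha]; positivity
  have hG : Tendsto (fun n => μ n (G n)ᶜ) atTop (𝓝 0) := by
    have hlim : Tendsto (fun n : ℕ => ENNReal.ofReal (2 * Real.exp (-(a / 2 * n)) + 4 / p n))
        atTop (𝓝 0) := by
      rw [← ENNReal.ofReal_zero]
      refine ENNReal.tendsto_ofReal ?_
      have h1 : Tendsto (fun n : ℕ => 2 * Real.exp (-(a / 2 * n))) atTop (𝓝 (2 * 0)) := by
        refine Tendsto.const_mul 2 (Real.tendsto_exp_neg_atTop_nhds_zero.comp ?_)
        exact tendsto_natCast_atTop_atTop.const_mul_atTop (by positivity)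
      have h2 : Tendsto (fun n : ℕ => (4 : ℝ) / p n) atTop (𝓝 0) :=
        (tendsto_natCast_atTop_atTop.comp hp).const_div_atTop 4
      simpa using h1.add h2
    refine tendsto_of_tendsto_of_tendsto_of_le_of_le' tendsto_const_nhds hlim
      (Eventually.of_forall fun _ => zero_le) ?_
    have hev1 : ∀ᶠ n in atTop, 2 * δ n ≤ 128 * (K * R) := by
      have h1 : Tendsto (fun n => 2 * δ n) atTop (𝓝 (2 * (40 * (K * R) * 0))) :=
        (hrate.const_mul _).const_mul 2
      rw [mul_zero, mul_zero] at h1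
      exact (h1.eventually_lt_const (by positivity : 0 < 128 * (K * R))).mono fun _ h => h.le
    -- The level `a / 10` gives `5 p log p ≤ a n / 2`, as `grid_term_le` requires.
    have hev2 := hscale.eventually_lt_const (by positivity : 0 < a / 10)
    filter_upwards [hev1, hev2, hp.eventually_ge_atTop 2, eventually_gt_atTop 0]
      with n hn1 hn2 hpn hn0
    have hn0' : (0 : ℝ) < n := by exact_mod_cast hn0
    have hr := CSCS.rate_nonneg 1 (p n) n
    have h1 := CSCS.measure_deviation_le (hmodel n) hC hκ (hsub n) (hchol n) (hsing n) hη
      (by rwa [← hKdef]) (by positivity : 0 ≤ δ n) (by rwa [← hKdef, ← hRdef])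
    refine h1.trans (ENNReal.ofReal_le_ofReal (add_le_add ?_ ?_))
    · rw [← hKdef]
      have h2 : (n : ℝ) * η ^ 2 / (2048 * K ^ 2) = a * n := by rw [ha]; ring
      rw [h2]
      refine CSCS.grid_term_le hpn ?_
      rw [div_lt_iff₀ hn0'] at hn2
      have h3 : 0 ≤ (CSCS.sparsity (L n) : ℝ) * Real.log (p n) :=
        mul_nonneg (Nat.cast_nonneg _) (Real.log_natCast_nonneg _)
      linarith
    · rw [← hKdef, ← hRdef]
      refine CSCS.pair_term_le hpn ?_
      have h2 : CSCS.rate 1 (p n) n ^ 2 = Real.log (p n) / n := by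
        rw [CSCS.rate, Nat.cast_one, one_mul, Real.sq_sqrt]
        exact div_nonneg (Real.log_natCast_nonneg _) (Nat.cast_nonneg _)
      have h3 : (n : ℝ) * (2 * δ n) ^ 2 / (2048 * (K * R) ^ 2) = 25 / 8 * Real.log (p n) := by
        simp only [δ, mul_pow, h2]
        field_simp
        ring
      rw [h3]
      linarith [Real.log_natCast_nonneg (p n)]
  have hgood : ∀ᶠ n in atTop, ∀ ω ∈ G n,
      (∃ M, CSCS.IsEstimate (CSCS.sampleCov fun k j => X n k j ω) (lam n) M) ∧
      ∀ M, CSCS.IsEstimate (CSCS.sampleCov fun k j => X n k j ω) (lam n) M →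
        CSCS.offDiagNorm (M - L n) ≤ c₂ * CSCS.rate (CSCS.sparsity (L n)) (p n) n := by
    have hev : ∀ᶠ n in atTop, 3 * (A * CSCS.rate 1 (p n) n) * κ ^ 3 ≤ 1 := by
      have h1 : Tendsto (fun n => 3 * (A * CSCS.rate 1 (p n) n) * κ ^ 3) atTop
          (𝓝 (3 * (A * 0) * κ ^ 3)) := ((hrate.const_mul A).const_mul 3).mul_const _
      rw [mul_zero, mul_zero, zero_mul] at h1
      exact (h1.eventually_lt_const one_pos).mono fun _ h => h.le
    filter_upwards [hev] with n hn ω hω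
    have hr := CSCS.rate_nonneg 1 (p n) n
    have hl1 := (hlam n).1
    have hl2 := (hlam n).2
    have hl0 : 0 ≤ lam n := le_trans (by positivity) hl1
    have h3 : 3 * lam n * κ ^ 3 ≤ 1 := by
      refine le_trans ?_ hn
      gcongr
    obtain ⟨h4, h5⟩ := CSCS.exists_isEstimate_and_offDiagNorm_le hκ
      (CSCS.sampleCov_transpose fun k j => X n k j ω) (hchol n) (hsing n) hη1 hω.1 hω.2
      (by simp only [δ]; linarith) hl0 h3
    refine ⟨h4, fun M hM => (h5 M hM).trans ?_⟩
    rw [CSCS.rate_eq_mul, ← mul_assoc]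
    refine mul_le_mul_of_nonneg_right ?_ (Real.sqrt_nonneg _)
    calc 6 * κ ^ 2 * lam n ≤ 6 * κ ^ 2 * (A * CSCS.rate 1 (p n) n) := by gcongr
      _ = 6 * κ ^ 2 * A * CSCS.rate 1 (p n) n := by ring
      _ ≤ c₂ * CSCS.rate 1 (p n) n := mul_le_mul_of_nonneg_right hc₂ hr
  have hmono : ∀ E : ∀ n, Set (Ω n), (∀ᶠ n in atTop, G n ⊆ E n) →
      CSCS.WithProbTendingToOne μ E := fun E hE =>
    tendsto_of_tendsto_of_tendsto_of_le_of_le' tendsto_const_nhds hG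
      (Eventually.of_forall fun _ => zero_le)
      (hE.mono fun n hn => measure_mono (Set.compl_subset_compl.2 hn))
  refine ⟨hmono _ (hgood.mono fun n hn ω hω => (hn ω hω).1),
    hmono _ (hgood.mono fun n hn ω hω => (hn ω hω).2),
    hmono _ (hgood.mono fun n hn ω hω M hM i j hij => ?_)⟩
  refine CSCS.sign_threshold_eq ?_ (hmin n) ((hn ω hω).2 M hM) hij
  rw [← mul_assoc]
  exact mul_le_mul_of_nonneg_right hc₁.le (CSCS.rate_nonneg _ _ _)
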